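/- Let $d\ge 1$, let $Q$ be a probability distribution on $\mathbb{R}^d\times\{0,1\}$ and $(X,Y)\sim Q$. Suppose $X$ has a Lebesgue density $\mu$, and let $\eta(X)=\mathbb{P}(Y=1\mid X)$. For $x>0$ let $\lfloor x\rfloor$ denote the largest integer $\ge 0$ that is strictly smaller than $x$. Fix $X_*\in\mathbb{R}^d$, $R\in(0,1)$, $\beta>0$, put $\omega=\lfloor\beta/2\rfloor$, and let $B_R(X_*)$ be the closed Euclidean ball. Let $\tilde r_n>0$ ($n\ge 1$) satisfy $\tilde r_n\to 0$ and $n^{1-\nu}\tilde r_n^d\to\infty$ for some $\nu>0$. Let $(X_1,Y_1),\dots,(X_n,Y_n)$ be i.i.d. from $Q$, $r_i=\|X_i-X_*\|_2$, $N_n=\#\{i: r_i\le\tilde r_n\}$. Let $\tilde R_n$ be the $N_n\times\omega$ matrix with rows $(r_i^2,r_i^4,\dots,r_i^{2\omega})$ over those $i$ with $r_i\le\tilde r_n$, let $\mathcal{P}=\tilde R_n(\tilde R_n^\top\tilde R_n)^{-1}\tilde R_n^\top$, and $\zeta_n=\langle 1_{N_n},\mathcal{P}1_{N_n}\rangle$,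 where $1_{N_n}=(1,\dots,1)^\top$. Assume: (C-1) there is $l>0$ with $\mu\ge l$ on $B_R(X_*)$; (C-2) each $f\in\{\mu,\eta\mu\}$ is $\beta$-Hölder at $X_*$: there are a polynomial $b_f$ of degree at most $\lfloor\beta\rfloor$ with $b_f(0)=0$ and a constant $L_f\in(0,\infty)$ such that $|f(x)-f(X_*)-b_f(x-X_*)|\le L_f\|x-X_*\|_2^\beta$ for all $x\in B_R(X_*)$; (C-3) there are $c,C_0,\tau>0$ and $\varphi\in(0,1)$ with $\mathbb{P}(\zeta_n\ge\varphi N_n)\le C_0\exp(-cn^\tau)$ for all $n\ge 1$. Define the truncated local radial regression estimator, with the $\varphi$ of (C-3), as follows. If $N_n\ge 1+\omega$ and $\zeta_n\le\varphi N_n$, then $\hat\eta_n(X_*)=\hat f_n(0)$, where $\hat f_n$ minimizes $\sum_{i=1}^n w_n(r_i)\{Y_i-f(r_i)\}^2$ over the functions $f(r)=\theta_0+\sum_{c=1}^{\omega}\theta_c r^{2c}$, with $w_n(r)=1/N_n$ for $r\le\tilde r_n$ and $w_n(r)=0$ otherwise. In all other cases $\hat\eta_n(X_*)=0$. Then there is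 a constant $C>0$, independent of $n$, such that for all $n\ge 1$ $$\mathbb{E}\big[\{\eta(X_*)-\hat\eta_n(X_*)\}^2\big]\le C\max\Big\{\tilde r_n^{2\beta},\ \frac{1}{n\tilde r_n^d}\Big\}.$$ -/

import Mathlib

open MeasureTheory ProbabilityTheory Filter Topology
open scoped Matrix

namespace LRR

noncomputable section

/-- The covariate space `ℝ^d` with the Euclidean norm. -/
abbrev Cov (d : ℕ) : Type := EuclideanSpace ℝ (Fin d)

/-- The largest natural number that is strictly smaller than `x`, for `x > 0`. -/
def strictFloor (x : ℝ) : ℕ := ⌈x⌉₊ - 1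

theorem isGreatest_strictFloor {x : ℝ} (hx : 0 < x) :
    IsGreatest {k : ℕ | (k : ℝ) < x} (strictFloor x) := by
  have h1 : 0 < ⌈x⌉₊ := Nat.ceil_pos.mpr hx
  constructor
  · have h2 : strictFloor x < ⌈x⌉₊ := by unfold strictFloor; omega
    exact Nat.lt_ceil.mp h2
  · intro k hk
    have h3 : k < ⌈x⌉₊ := Nat.lt_ceil.mpr hk
    unfold strictFloor; omega

/-! ### The population -/

/-- `μ` is a probability density, with respect to Lebesgue measure, of the covariate `X` when
`(X, Y)` has the distribution `Q`. -/
structure IsCovariateDensity {d : ℕ} (Q : Measure (Cov d × Fin 2)) (μ : Cov d → ℝ) : Prop where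
  measurable : Measurable μ
  nonneg : ∀ x, 0 ≤ μ x
  map_fst : Q.map Prod.fst = (volume : Measure (Cov d)).withDensity fun x => ENNReal.ofReal (μ x)

/-- `η` is a version of the label probability: `η(X) = ℙ(Y = 1 ∣ X)` almost surely when `(X, Y)`
has the distribution `Q`. -/
structure IsLabelProbability {d : ℕ} (Q : Measure (Cov d × Fin 2)) (η : Cov d → ℝ) : Prop where
  measurable : Measurable η
  mem_Icc : ∀ x, η x ∈ Set.Icc (0 : ℝ) 1
  ae_eq : (fun p : Cov d × Fin 2 => η p.1) =ᵐ[Q]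
    Q⟦{p : Cov d × Fin 2 | p.2 = 1} |
      MeasurableSpace.comap (Prod.fst : Cov d × Fin 2 → Cov d) inferInstance⟧

/-- `f` is `β`-Hölder at the point `xs` over the closed ball of radius `R`: up to an error of at
most `L ‖x - xs‖ ^ β` it is `f xs` plus a polynomial in `x - xs` without constant term, of degree
at most the largest integer strictly smaller than `β`. -/
def IsHolderOnBall {d : ℕ} (β R : ℝ) (xs : Cov d) (f : Cov d → ℝ) : Prop :=
  ∃ b : MvPolynomial (Fin d) ℝ, ∃ L : ℝ,
    b.totalDegree ≤ strictFloor β ∧ MvPolynomial.eval (fun _ => (0 : ℝ)) b = 0 ∧ 0 < L ∧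
    ∀ x ∈ Metric.closedBall xs R,
      |f x - (f xs + MvPolynomial.eval (fun i => (x - xs) i) b)| ≤ L * ‖x - xs‖ ^ β

/-! ### The sample

A data set of size `n` is `D : Fin n → Cov d × Fin 2`. Sorting the observations by their distance
to the query would only permute the terms of the sums and the rows of the matrix below, so the
observations keep their original indices. -/

variable {d n : ℕ} (xs : Cov d) (r : ℝ) (D : Fin n → Cov d × Fin 2)

/-- The distance from the `i`-th covariate to the query `xs`. -/
def radius (i : Fin n) : ℝ := ‖(D i).1 - xs‖

/-- The `i`-th label, as a real number in `{0, 1}`. -/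
def label (i : Fin n) : ℝ := (((D i).2 : ℕ) : ℝ)

/-- The indices of the observations at distance at most `r` from the query. -/
def nearby : Finset (Fin n) := Finset.univ.filter fun i => radius xs D i ≤ r

/-- The number of observations at distance at most `r` from the query. -/
def numNearby : ℕ := (nearby xs r D).card

/-- The matrix whose rows are `(rᵢ², rᵢ⁴, …, rᵢ^(2w))` for the nearby observations `i`. -/
def radialMatrix (w : ℕ) : Matrix (nearby xs r D) (Fin w) ℝ :=
  Matrix.of fun i j => radius xs D i ^ (2 * ((j : ℕ) + 1))

/-- The projection matrix `A (Aᵀ A)⁻¹ Aᵀ` onto the column space of `A`. (For a singular `Aᵀ A` this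
is `0` here. For the radial matrix that can only happen with fewer than `w` nearby observations,
where the estimator is `0` anyway, or with ties or zero distances, a null event.) -/
def projMatrix {ι κ : Type*} [Fintype ι] [Fintype κ] [DecidableEq κ]
    (A : Matrix ι κ ℝ) : Matrix ι ι ℝ :=
  A * (Aᵀ * A)⁻¹ * Aᵀ

/-- The statistic `⟨1, P 1⟩`, with `P` the projection matrix of the radial matrix. -/
def zeta (w : ℕ) : ℝ :=
  (fun _ => (1 : ℝ)) ⬝ᵥ (projMatrix (radialMatrix xs r D w) *ᵥ fun _ => (1 : ℝ))

/-! ### The estimator -/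

/-- The boxcar weight `1 / N` on `[0, r]` and `0` beyond. -/
def boxcarWeight (r : ℝ) (N : ℕ) (t : ℝ) : ℝ := if t ≤ r then 1 / (N : ℝ) else 0

theorem boxcarWeight_nonneg (r : ℝ) (N : ℕ) (t : ℝ) : 0 ≤ boxcarWeight r N t := by
  unfold boxcarWeight; split_ifs <;> positivity

/-- The polynomials `θ₀ + θ₁ t² + ⋯ + θ_w t^(2w)`. -/
def evenPolynomials (w : ℕ) : Set (ℝ → ℝ) :=
  {f | ∃ θ : Fin (w + 1) → ℝ, f = fun t => ∑ c, θ c * t ^ (2 * (c : ℕ))}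

/-- The weighted squared loss of a radial regression function. -/
def weightedLoss (f : ℝ → ℝ) : ℝ :=
  ∑ i, boxcarWeight r (numNearby xs r D) (radius xs D i) * (label D i - f (radius xs D i)) ^ 2

/-- The weighted squared loss has a minimizer among the even polynomials. -/
theorem exists_minimizer (w : ℕ) :
    ∃ f ∈ evenPolynomials w, ∀ g ∈ evenPolynomials w,
      weightedLoss xs r D f ≤ weightedLoss xs r D g := by
  let s : Fin n → ℝ := fun i => √(boxcarWeight r (numNearby xs r D) (radius xs D i))
  have hs : ∀ i, s i ^ 2 = boxcarWeight r (numNearby xs r D) (radius xs D i) := fun i =>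
    Real.sq_sqrt (boxcarWeight_nonneg _ _ _)
  let T : (Fin (w + 1) → ℝ) →ₗ[ℝ] EuclideanSpace ℝ (Fin n) :=
    { toFun := fun θ => WithLp.toLp 2 fun i => s i * ∑ c, θ c * radius xs D i ^ (2 * (c : ℕ))
      map_add' := by
        intro a b; ext i
        simp [add_mul, Finset.sum_add_distrib, mul_add]
      map_smul' := by
        intro a b; ext i
        simp only [Pi.smul_apply, smul_eq_mul, RingHom.id_apply, PiLp.smul_apply, mul_assoc,
          ← Finset.mul_sum]
        ring }
  let u : EuclideanSpace ℝ (Fin n) := WithLp.toLp 2 fun i => s i * label D i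
  have key : ∀ θ : Fin (w + 1) → ℝ,
      weightedLoss xs r D (fun t => ∑ c, θ c * t ^ (2 * (c : ℕ))) = ‖u - T θ‖ ^ 2 := by
    intro θ
    rw [EuclideanSpace.norm_sq_eq]
    unfold weightedLoss
    refine Finset.sum_congr rfl fun i _ => ?_
    rw [← hs i, Real.norm_eq_abs, sq_abs]
    simp only [u, T, LinearMap.coe_mk, AddHom.coe_mk, PiLp.sub_apply]
    ring
  obtain ⟨v, hv, hmin⟩ := (LinearMap.range T).exists_norm_eq_iInf_of_complete_subspace
    (Submodule.complete_of_finiteDimensional _) u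
  obtain ⟨θ, rfl⟩ := hv
  refine ⟨_, ⟨θ, rfl⟩, ?_⟩
  rintro g ⟨θ', rfl⟩
  rw [key, key]
  have hle : ‖u - T θ‖ ≤ ‖u - T θ'‖ := by
    rw [hmin]
    exact ciInf_le (f := fun y : LinearMap.range T => ‖u - y‖)
      ⟨0, by rintro _ ⟨y, rfl⟩; positivity⟩ ⟨T θ', θ', rfl⟩
  gcongr

/-- A minimizer of the weighted squared loss among the even polynomials. -/
def fitted (w : ℕ) : ℝ → ℝ := (exists_minimizer xs r D w).choose

/-- The event on which the estimator is taken from the regression: there are at least `1 + w`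
nearby observations and the projection statistic is at most `φ` times their number. -/
def goodEvent (w : ℕ) (φ : ℝ) : Prop :=
  1 + w ≤ numNearby xs r D ∧ zeta xs r D w ≤ φ * numNearby xs r D

open Classical in
/-- The truncated local radial regression estimator at the query `xs`. -/
def estimator (w : ℕ) (φ : ℝ) : ℝ :=
  if goodEvent xs r D w φ then fitted xs r D w 0 else 0

/-- The law of `n` independent observations from `Q`. -/
def sampleLaw {d : ℕ} (Q : Measure (Cov d × Fin 2)) (n : ℕ) :
    Measure (Fin n → Cov d × Fin 2) :=
  Measure.pi fun _ => Q

end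

end LRR

namespace LRR

/-! ### Radial integrals of homogeneous functions and polynomials -/

section Radial

variable {E : Type*} [NormedAddCommGroup E] [NormedSpace ℝ E] [FiniteDimensional ℝ E]
  [MeasurableSpace E] [BorelSpace E]

/-! The estimator sees the covariates only through their distances to `xs`, so the regression
function that matters is `m = E[Y | ‖X - xs‖]`, not `η`. At distance `t`, `m` is the ratio of the
averages of `η μ` and `μ` over the sphere of radius `t`. Averaging over a sphere kills the odd
monomials and turns those of degree `2k` into multiples of `t ^ (2k)`, so up to `O(t ^ β)` this is a
ratio `A(t²) / U(t²)` with `U(0) = μ xs > 0`. Dividing by increasing powers gives `p` of degree at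
most `w` with `p(0) = η xs` and `|m - p(t²)| ≤ C t ^ β`, because `β ≤ 2(w + 1)`
(`exists_radial_regression`).

The estimator is almost surely linear in the labels (`estimator_eq`). Its weights are the residual
of the constant regressor after projection on the radial columns, divided by `N - ζ`. They depend on
the distances only, reproduce the value at zero of even polynomials of degree at most `2w`, and have
sum of squares `1 / (N - ζ) ≤ 1 / ((1 - φ) N)` on the good event.

There the error is, up to sign, `∑ W i (Y i - m i) + ∑ W i (m i - p(r i ²))`. By Cauchy–Schwarz the
square of the second sum is at most a constant times `r ^ (2β)`. The first sum has no cross terms in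
its second moment, since `Y - m` is centered given the distance (`integral_sq_sum_mul_eq`); that
moment is of order `E[1/N; N > 0]`, hence `1 / (n r ^ d)` because `N` has variance at most its mean.
Off the good event the estimator is zero and the squared error is at most one: too few neighbours is
again a Chebyshev event, and a large `ζ` has the assumed stretched exponential probability. -/

theorem integral_radial_mul_homogeneous (ν : Measure E) [ν.IsAddHaarMeasure] [Nontrivial E]
    {k : ℕ} {f : E → ℝ} (hf : ∀ (c : ℝ) (x : E), 0 < c → f (c • x) = c ^ k * f x) (g : ℝ → ℝ) :
    ∫ x, g ‖x‖ * f x ∂ν =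
      (∫ u : Metric.sphere (0 : E) 1, f u ∂ν.toSphere) *
        ∫ t, g (t : ℝ) * (t : ℝ) ^ k ∂(Measure.volumeIoiPow (Module.finrank ℝ E - 1)) := by
  calc ∫ x, g ‖x‖ * f x ∂ν
      = ∫ x : ({(0)}ᶜ : Set E), g ‖x.1‖ * f x.1 ∂(ν.comap (↑)) := by
        rw [integral_subtype_comap (measurableSet_singleton _).compl fun x ↦ g ‖x‖ * f x,
          restrict_compl_singleton]
    _ = ∫ p, f p.1 * (g p.2 * (p.2 : ℝ) ^ k)
          ∂(ν.toSphere.prod (Measure.volumeIoiPow (Module.finrank ℝ E - 1))) := by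
        -- Polar coordinates: the measure becomes a product of sphere and radius, and homogeneity
        -- factors the integrand accordingly.
        rw [← ν.measurePreserving_homeomorphUnitSphereProd.integral_comp
          (Homeomorph.measurableEmbedding _)]
        refine integral_congr_ae (Eventually.of_forall fun x => ?_)
        have hx : 0 < ‖(x : E)‖ := norm_pos_iff.mpr x.2
        have h1 : (x : E) = ‖(x : E)‖ • (‖(x : E)‖⁻¹ • (x : E)) := by
          rw [smul_smul, mul_inv_cancel₀ hx.ne', one_smul]
        have h2 := hf ‖(x : E)‖ (‖(x : E)‖⁻¹ • (x : E)) hx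
        rw [← h1] at h2
        simp only [homeomorphUnitSphereProd_apply_snd_coe, homeomorphUnitSphereProd_apply_fst_coe]
        rw [h2]
        ring
    _ = _ := integral_prod_mul (fun u : Metric.sphere (0 : E) 1 => f u)
        (fun t : Set.Ioi (0 : ℝ) => g (t : ℝ) * (t : ℝ) ^ k)

/-- In polar coordinates `f` and `‖x‖ ^ k` have the same radial factor, so `c` is the ratio of their
integrals over the sphere and does not depend on `g`. -/
theorem exists_integral_radial_mul_homogeneous (ν : Measure E) [ν.IsAddHaarMeasure] [Nontrivial E]
    {k : ℕ} {f : E → ℝ} (hf : ∀ (c : ℝ) (x : E), 0 < c → f (c • x) = c ^ k * f x) :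
    ∃ c : ℝ, ∀ g : ℝ → ℝ, ∫ x, g ‖x‖ * f x ∂ν = c * ∫ x, g ‖x‖ * ‖x‖ ^ k ∂ν := by
  have hn : ∀ (c : ℝ) (x : E), 0 < c → ‖c • x‖ ^ k = c ^ k * ‖x‖ ^ k := fun c x hc => by
    rw [norm_smul, Real.norm_of_nonneg hc.le, mul_pow]
  have hs : ∫ u : Metric.sphere (0 : E) 1, ‖(u : E)‖ ^ k ∂ν.toSphere ≠ 0 := by
    have : ∀ u : Metric.sphere (0 : E) 1, ‖(u : E)‖ ^ k = 1 := fun u => by simp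
    simp only [this, integral_const, smul_eq_mul, mul_one]
    rw [Measure.real, ENNReal.toReal_ne_zero]
    exact ⟨by rw [Ne, Measure.measure_univ_eq_zero]; exact Measure.toSphere_ne_zero ν,
      measure_ne_top _ _⟩
  refine ⟨(∫ u : Metric.sphere (0 : E) 1, f u ∂ν.toSphere) /
    ∫ u : Metric.sphere (0 : E) 1, ‖(u : E)‖ ^ k ∂ν.toSphere, fun g => ?_⟩
  rw [integral_radial_mul_homogeneous ν hf, integral_radial_mul_homogeneous ν hn, ← mul_assoc,
    div_mul_cancel₀ _ hs]

theorem integral_radial_mul_odd (ν : Measure E) [ν.IsAddHaarMeasure]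
    {f : E → ℝ} (hf : ∀ x, f (-x) = - f x) (g : ℝ → ℝ) :
    ∫ x, g ‖x‖ * f x ∂ν = 0 := by
  have h := integral_neg_eq_self (fun x => g ‖x‖ * f x) ν
  simp only [norm_neg, hf, mul_neg, integral_neg] at h
  linarith

theorem integrable_radial_mul_continuous (ν : Measure E) [IsFiniteMeasureOnCompacts ν]
    {g : ℝ → ℝ} (hg : Measurable g) {M K : ℝ} (hM : ∀ t, |g t| ≤ M) (hK : ∀ t, K < t → g t = 0)
    {f : E → ℝ} (hf : Continuous f) :
    Integrable (fun x => g ‖x‖ * f x) ν := by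
  have h1 : IntegrableOn f (Metric.closedBall 0 K) ν :=
    hf.continuousOn.integrableOn_compact (isCompact_closedBall _ _)
  have h2 : IntegrableOn (fun x => g ‖x‖ * f x) (Metric.closedBall 0 K) ν :=
    h1.bdd_mul (c := M) (hg.comp measurable_norm).aestronglyMeasurable
      (Eventually.of_forall fun x => by simpa using hM ‖x‖)
  refine (integrableOn_iff_integrable_of_support_subset ?_).mp h2
  intro x hx
  by_contra hx'
  refine hx ?_
  simp only [Metric.mem_closedBall, dist_zero_right, not_le] at hx'
  simp [hK _ hx']

end Radial

/-- Integrated against a radial function, a polynomial is an even polynomial in the norm. -/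
theorem exists_polynomial_integral_radial_mul {d : ℕ} (hd : 0 < d) (b : MvPolynomial (Fin d) ℝ) :
    ∃ q : Polynomial ℝ, q.eval 0 = MvPolynomial.eval (fun _ => (0 : ℝ)) b ∧
      ∀ (g : ℝ → ℝ) (M K : ℝ), Measurable g → (∀ t, |g t| ≤ M) → (∀ t, K < t → g t = 0) →
        ∫ z : Cov d, g ‖z‖ * MvPolynomial.eval (fun i => z i) b =
          ∫ z : Cov d, g ‖z‖ * q.eval (‖z‖ ^ 2) := by
  have : Nonempty (Fin d) := ⟨⟨0, hd⟩⟩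
  have hcont : ∀ b : MvPolynomial (Fin d) ℝ,
      Continuous fun z : Cov d => MvPolynomial.eval (fun i => z i) b := fun b =>
    (MvPolynomial.continuous_eval b).comp (by fun_prop)
  have hcont' : ∀ q : Polynomial ℝ, Continuous fun z : Cov d => q.eval (‖z‖ ^ 2) := fun q =>
    q.continuous.comp (by fun_prop)
  induction b using MvPolynomial.induction_on' with
  | monomial s a =>
    have heval : ∀ z : Cov d, MvPolynomial.eval (fun i => z i) (MvPolynomial.monomial s a) =
        a * ∏ i, z i ^ s i := fun z => by
      rw [MvPolynomial.eval_monomial, Finsupp.prod_fintype _ _ (by simp)]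
    have hsmul : ∀ (c : ℝ) (z : Cov d),
        MvPolynomial.eval (fun i => (c • z) i) (MvPolynomial.monomial s a) =
          c ^ (∑ i, s i) * MvPolynomial.eval (fun i => z i) (MvPolynomial.monomial s a) := by
      intro c z
      rw [heval, heval]
      simp only [PiLp.smul_apply, smul_eq_mul, mul_pow, Finset.prod_mul_distrib,
        Finset.prod_pow_eq_pow_sum]
      ring
    -- Only the constant monomial contributes to the value at zero.
    by_cases hs : s = 0
    · subst hs
      exact ⟨Polynomial.C a, by simp, fun g M K _ _ _ => by simp⟩
    have hs0 : ∑ i, s i ≠ 0 := by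
      obtain ⟨i, hi⟩ := Finsupp.ne_iff.mp hs
      have := Finset.single_le_sum (f := fun i => s i) (fun _ _ => Nat.zero_le _)
        (Finset.mem_univ i)
      simp only [Finsupp.coe_zero, Pi.zero_apply] at hi this
      omega
    have hzero : MvPolynomial.eval (fun _ => (0 : ℝ)) (MvPolynomial.monomial s a) = 0 := by
      have := hsmul 0 0
      rw [zero_pow hs0, zero_mul] at this
      simpa using this
    rcases Nat.even_or_odd' (∑ i, s i) with ⟨k, hk | hk⟩
    · obtain ⟨c, hc⟩ := exists_integral_radial_mul_homogeneous (volume : Measure (Cov d))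
        (f := fun z => MvPolynomial.eval (fun i => z i) (MvPolynomial.monomial s a))
        (k := ∑ i, s i) (fun c z _ => hsmul c z)
      refine ⟨Polynomial.C c * Polynomial.X ^ k, ?_, fun g M K _ _ _ => ?_⟩
      · rw [hzero]
        simp
        right
        omega
      · rw [hc g, ← integral_const_mul, hk]
        refine integral_congr_ae (Eventually.of_forall fun z => ?_)
        simp [pow_mul]
        ring
    · refine ⟨0, by rw [hzero, Polynomial.eval_zero], fun g M K _ _ _ => ?_⟩
      rw [integral_radial_mul_odd (volume : Measure (Cov d))
        (f := fun z => MvPolynomial.eval (fun i => z i) (MvPolynomial.monomial s a))]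
      · simp
      · intro z
        have := hsmul (-1) z
        rw [hk, (odd_two_mul_add_one k).neg_one_pow] at this
        simpa using this
  | add p q hp hq =>
    obtain ⟨p', hp0, hp'⟩ := hp
    obtain ⟨q', hq0, hq'⟩ := hq
    refine ⟨p' + q', by simp [hp0, hq0], fun g M K hg hM hK => ?_⟩
    simp only [map_add, Polynomial.eval_add, mul_add]
    rw [integral_add (integrable_radial_mul_continuous _ hg hM hK (hcont p))
        (integrable_radial_mul_continuous _ hg hM hK (hcont q)),
      integral_add (integrable_radial_mul_continuous _ hg hM hK (hcont' p'))
        (integrable_radial_mul_continuous _ hg hM hK (hcont' q')),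
      hp' g M K hg hM hK, hq' g M K hg hM hK]

/-- Division of polynomials by increasing powers. -/
theorem exists_X_pow_dvd_sub_mul {F : Type*} [Field F] (A U : Polynomial F) (hU : U.eval 0 ≠ 0)
    (w : ℕ) : ∃ p : Polynomial F, p.natDegree ≤ w ∧ Polynomial.X ^ (w + 1) ∣ A - p * U := by
  have hdvd : ∀ B : Polynomial F, Polynomial.X ∣ B - Polynomial.C (B.eval 0 / U.eval 0) * U := by
    intro B
    rw [Polynomial.X_dvd_iff, Polynomial.coeff_zero_eq_eval_zero]
    simp [hU]
  induction w with
  | zero => exact ⟨Polynomial.C (A.eval 0 / U.eval 0), by simp, by simpa using hdvd A⟩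
  | succ k ih =>
    obtain ⟨p, hp, B, hB⟩ := ih
    -- The new term cancels the constant coefficient of the quotient `B`, so that one more power of
    -- `X` divides the remainder.
    refine ⟨p + Polynomial.C (B.eval 0 / U.eval 0) * Polynomial.X ^ (k + 1), ?_, ?_⟩
    · refine (Polynomial.natDegree_add_le _ _).trans (max_le (by omega) ?_)
      exact Polynomial.natDegree_C_mul_X_pow_le _ _
    · obtain ⟨D, hD⟩ := hdvd B
      refine ⟨D, ?_⟩
      calc A - (p + Polynomial.C (B.eval 0 / U.eval 0) * Polynomial.X ^ (k + 1)) * U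
          = (A - p * U) - Polynomial.X ^ (k + 1) * (Polynomial.C (B.eval 0 / U.eval 0) * U) := by
            ring
        _ = Polynomial.X ^ (k + 1) * (B - Polynomial.C (B.eval 0 / U.eval 0) * U) := by
            rw [hB]; ring
        _ = _ := by rw [hD]; ring

theorem integral_add_sub_add {α : Type*} [MeasurableSpace α] {ν : Measure α} {f₁ f₂ f₃ f₄ : α → ℝ}
    (h₁ : Integrable f₁ ν) (h₂ : Integrable f₂ ν) (h₃ : Integrable f₃ ν) (h₄ : Integrable f₄ ν) :
    ∫ x, (f₁ x + f₂ x - (f₃ x + f₄ x)) ∂ν =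
      (∫ x, f₁ x ∂ν) + (∫ x, f₂ x ∂ν) - ((∫ x, f₃ x ∂ν) + ∫ x, f₄ x ∂ν) := by
  rw [← integral_add h₁ h₂, ← integral_add h₃ h₄]
  exact integral_sub (h₁.add h₂) (h₃.add h₄)

/-- The average of a regression function over the points at a given distance from the query is an
even polynomial in the distance, up to a Hölder error. -/
theorem exists_polynomial_radial_bias {d : ℕ} (hd : 0 < d) {μ η : Cov d → ℝ}
    (hμ_int : Integrable μ) (hη_meas : Measurable η)
    (hη : ∀ x, η x ∈ Set.Icc (0 : ℝ) 1) {xs : Cov d} {R β : ℝ} (hβ : 0 < β) (hR : 0 < R) (hR1 : R < 1)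
    {l : ℝ} (hl : 0 < l) (hC1 : ∀ x ∈ Metric.closedBall xs R, l ≤ μ x)
    (hμH : IsHolderOnBall β R xs μ) (hημH : IsHolderOnBall β R xs (fun x => η x * μ x))
    {w : ℕ} (hw : β ≤ 2 * (w + 1)) :
    ∃ p : Polynomial ℝ, ∃ C : ℝ, p.natDegree ≤ w ∧ p.eval 0 = η xs ∧ 0 ≤ C ∧
      ∀ T : Set ℝ, MeasurableSet T → T ⊆ Set.Icc 0 R →
        |∫ z : Cov d, T.indicator 1 ‖z‖ * ((η (xs + z) - p.eval (‖z‖ ^ 2)) * μ (xs + z))| ≤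
          C * ∫ z : Cov d, T.indicator 1 ‖z‖ * (‖z‖ ^ β * μ (xs + z)) := by
  obtain ⟨b₂, L₂, -, hb₂, hL₂, hh₂⟩ := hμH
  obtain ⟨b₁, L₁, -, hb₁, hL₁, hh₁⟩ := hημH
  obtain ⟨q₁, hq₁0, hq₁⟩ := exists_polynomial_integral_radial_mul hd b₁
  obtain ⟨q₂, hq₂0, hq₂⟩ := exists_polynomial_integral_radial_mul hd b₂
  have hxs : l ≤ μ xs := hC1 xs (Metric.mem_closedBall_self hR.le)
  have hμxs : μ xs ≠ 0 := (hl.trans_le hxs).ne'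
  -- `A` and `U` are the spherical averages of the Hölder polynomials of `η μ` and `μ`, in the
  -- variable `t²`; `p` is their quotient to order `w`.
  set A : Polynomial ℝ := Polynomial.C (η xs * μ xs) + q₁ with hA
  set U : Polynomial ℝ := Polynomial.C (μ xs) + q₂ with hU
  have hA0 : A.eval 0 = η xs * μ xs := by
    rw [hA, Polynomial.eval_add, Polynomial.eval_C, hq₁0, hb₁, add_zero]
  have hU0 : U.eval 0 = μ xs := by
    rw [hU, Polynomial.eval_add, Polynomial.eval_C, hq₂0, hb₂, add_zero]
  obtain ⟨p, hpdeg, D, hD⟩ := exists_X_pow_dvd_sub_mul A U (by rwa [hU0]) w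
  have hp0 : p.eval 0 = η xs := by
    have := congrArg (Polynomial.eval 0) hD
    simp only [Polynomial.eval_sub, Polynomial.eval_mul, Polynomial.eval_pow, Polynomial.eval_X,
      hA0, hU0, zero_pow (Nat.succ_ne_zero w), zero_mul] at this
    exact (mul_right_cancel₀ hμxs (sub_eq_zero.mp this)).symm
  have hbound : ∀ q : Polynomial ℝ, ∃ M : ℝ, 0 ≤ M ∧ ∀ t ∈ Set.Icc (0 : ℝ) 1, |q.eval t| ≤ M := by
    intro q
    obtain ⟨M, hM⟩ := isCompact_Icc.exists_bound_of_continuousOn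
      (q.continuous.continuousOn (s := Set.Icc (0 : ℝ) 1))
    exact ⟨M, (norm_nonneg _).trans (hM 0 (by simp)), hM⟩
  obtain ⟨M, hM0, hM⟩ := hbound p
  obtain ⟨K, hK0, hK⟩ := hbound D
  have hsq : ∀ t ∈ Set.Icc (0 : ℝ) R, t ^ 2 ∈ Set.Icc (0 : ℝ) 1 := fun t ht =>
    ⟨by positivity, pow_le_one₀ ht.1 (ht.2.trans hR1.le)⟩
  have hdiff : ∀ t ∈ Set.Icc (0 : ℝ) R, |(A - p * U).eval (t ^ 2)| ≤ K * t ^ β := by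
    intro t ht
    -- Lowering the exponent from `2(w + 1)` to `β` needs a base in `(0, 1]`, so `t = 0` is
    -- separate.
    rcases ht.1.eq_or_lt with h0 | h0
    · rw [← h0, hD]
      simp only [Polynomial.eval_mul, Polynomial.eval_pow, Polynomial.eval_X]
      simp only [ne_eq, OfNat.ofNat_ne_zero, not_false_eq_true, zero_pow, Nat.add_eq_zero_iff,
        one_ne_zero, and_false, zero_mul, abs_zero]
      positivity
    rw [hD, Polynomial.eval_mul, abs_mul, mul_comm]
    refine mul_le_mul (hK _ (hsq t ht)) ?_ (abs_nonneg _) hK0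
    rw [Polynomial.eval_pow, Polynomial.eval_X, abs_of_nonneg (by positivity), ← pow_mul,
      ← Real.rpow_natCast]
    exact Real.rpow_le_rpow_of_exponent_ge h0 (ht.2.trans hR1.le) (by push_cast; linarith)
  -- `L₁` and `M * L₂` are the Hölder errors of `η μ` and of `p` times `μ`, `K` is the division
  -- remainder, and `1 / l` inserts `μ` on the right-hand side.
  refine ⟨p, (L₁ + M * L₂ + K) / l, hpdeg, hp0, by positivity, fun T hT hTR => ?_⟩
  set g : ℝ → ℝ := T.indicator 1 with hg
  have hg_meas : Measurable g := measurable_one.indicator hT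
  have hg0 : ∀ t, 0 ≤ g t := fun t => Set.indicator_nonneg (fun _ _ => zero_le_one) t
  have hg1 : ∀ t, |g t| ≤ 1 := fun t => by
    by_cases ht : t ∈ T <;> simp [hg, ht]
  have hgR : ∀ t, R < t → g t = 0 := fun t ht =>
    Set.indicator_of_notMem (fun h => absurd (hTR h).2 (not_le.mpr ht)) _
  have hgp_meas : Measurable fun t => g t * p.eval (t ^ 2) :=
    hg_meas.mul (p.continuous.measurable.comp (measurable_id.pow_const 2))
  have hgp1 : ∀ t, |g t * p.eval (t ^ 2)| ≤ M := fun t => by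
    by_cases ht : t ∈ T
    · simpa [hg, ht] using hM _ (hsq t (hTR ht))
    · simpa [hg, ht] using hM0
  have hgpR : ∀ t, R < t → g t * p.eval (t ^ 2) = 0 := fun t ht => by rw [hgR t ht, zero_mul]
  have hcont : ∀ b : MvPolynomial (Fin d) ℝ,
      Continuous fun z : Cov d => MvPolynomial.eval (fun i => z i) b := fun b =>
    (MvPolynomial.continuous_eval b).comp (by fun_prop)
  have hcont' : ∀ q : Polynomial ℝ, Continuous fun z : Cov d => q.eval (‖z‖ ^ 2) := fun q =>
    q.continuous.comp (by fun_prop)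
  have hμ_shift : Integrable fun z : Cov d => μ (xs + z) := hμ_int.comp_add_left xs
  have hmain : Integrable fun z : Cov d =>
      g ‖z‖ * ((η (xs + z) - p.eval (‖z‖ ^ 2)) * μ (xs + z)) := by
    have : Integrable fun z : Cov d => (g ‖z‖ * η (xs + z) - g ‖z‖ * p.eval (‖z‖ ^ 2)) *
        μ (xs + z) := by
      refine hμ_shift.bdd_mul (c := 1 + M) ?_ (Eventually.of_forall fun z => ?_)
      · exact (((hg_meas.comp measurable_norm).mul
          (hη_meas.comp (measurable_const_add xs))).sub
            (hgp_meas.comp measurable_norm)).aestronglyMeasurable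
      · refine (abs_sub _ _).trans (add_le_add ?_ (hgp1 ‖z‖))
        rw [abs_mul, abs_of_nonneg (hη (xs + z)).1]
        exact mul_le_one₀ (hg1 _) (hη _).1 (hη _).2
    refine this.congr (Eventually.of_forall fun z => ?_)
    simp only
    ring
  -- The integrand with `η μ` and `μ` replaced by their Hölder polynomials. Since `p(‖z‖²)` is
  -- itself radial, it can join the radial factor when these are averaged over spheres.
  set N : Cov d → ℝ := fun z => (η xs * μ xs + MvPolynomial.eval (fun i => z i) b₁) -
    p.eval (‖z‖ ^ 2) * (μ xs + MvPolynomial.eval (fun i => z i) b₂) with hN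
  have hN_int : Integrable fun z => g ‖z‖ * N z :=
    integrable_radial_mul_continuous _ hg_meas hg1 hgR
      ((continuous_const.add (hcont b₁)).sub ((hcont' p).mul (continuous_const.add (hcont b₂))))
  have hN_eq : ∫ z, g ‖z‖ * N z = ∫ z : Cov d, g ‖z‖ * (A - p * U).eval (‖z‖ ^ 2) := by
    have e1 : ∀ z, g ‖z‖ * N z = g ‖z‖ * (η xs * μ xs) +
        g ‖z‖ * MvPolynomial.eval (fun i => z i) b₁ - ((g ‖z‖ * p.eval (‖z‖ ^ 2)) * μ xs +
          (g ‖z‖ * p.eval (‖z‖ ^ 2)) * MvPolynomial.eval (fun i => z i) b₂) := fun z => by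
      simp only [hN]; ring
    have e2 : ∀ z : Cov d, g ‖z‖ * (A - p * U).eval (‖z‖ ^ 2) = g ‖z‖ * (η xs * μ xs) +
        g ‖z‖ * q₁.eval (‖z‖ ^ 2) - ((g ‖z‖ * p.eval (‖z‖ ^ 2)) * μ xs +
          (g ‖z‖ * p.eval (‖z‖ ^ 2)) * q₂.eval (‖z‖ ^ 2)) := fun z => by
      simp only [hA, hU, Polynomial.eval_sub, Polynomial.eval_mul, Polynomial.eval_add,
        Polynomial.eval_C]
      ring
    have i1 := integrable_radial_mul_continuous (volume : Measure (Cov d)) hg_meas hg1 hgR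
      (f := fun _ => η xs * μ xs) continuous_const
    have i2 := integrable_radial_mul_continuous (volume : Measure (Cov d)) hgp_meas hgp1 hgpR
      (f := fun _ => μ xs) continuous_const
    have j1 := integrable_radial_mul_continuous (volume : Measure (Cov d)) hg_meas hg1 hgR
      (hcont b₁)
    have j2 := integrable_radial_mul_continuous (volume : Measure (Cov d)) hgp_meas hgp1 hgpR
      (hcont b₂)
    have k1 := integrable_radial_mul_continuous (volume : Measure (Cov d)) hg_meas hg1 hgR
      (hcont' q₁)
    have k2 := integrable_radial_mul_continuous (volume : Measure (Cov d)) hgp_meas hgp1 hgpR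
      (hcont' q₂)
    simp only [e1, e2]
    rw [integral_add_sub_add i1 j1 i2 j2, integral_add_sub_add i1 k1 i2 k2,
      hq₁ g 1 R hg_meas hg1 hgR, hq₂ _ M R hgp_meas hgp1 hgpR]
  have hpow_int : Integrable fun z : Cov d => g ‖z‖ * (‖z‖ ^ β * μ (xs + z)) := by
    simp only [← mul_assoc]
    refine hμ_shift.bdd_mul (c := 1) ?_ (Eventually.of_forall fun z => ?_)
    · exact ((hg_meas.comp measurable_norm).mul
        (measurable_norm.pow_const β)).aestronglyMeasurable
    · rw [norm_mul, Real.norm_of_nonneg (by positivity : 0 ≤ ‖z‖ ^ β)]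
      rcases le_or_gt ‖z‖ R with hz | hz
      · exact mul_le_one₀ (hg1 _) (by positivity)
          (Real.rpow_le_one (norm_nonneg _) (hz.trans hR1.le) hβ.le)
      · simp [hgR _ hz]
  have hpw : ∀ z : Cov d, ‖z‖ ≤ R →
      |(η (xs + z) - p.eval (‖z‖ ^ 2)) * μ (xs + z) - N z| ≤ (L₁ + M * L₂) * ‖z‖ ^ β := by
    intro z hz
    have hmem : xs + z ∈ Metric.closedBall xs R := by simpa using hz
    have a1 := hh₁ _ hmem
    have a2 := hh₂ _ hmem
    simp only [add_sub_cancel_left] at a1 a2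
    have hMz := hM _ (hsq ‖z‖ ⟨norm_nonneg z, hz⟩)
    have e : (η (xs + z) - p.eval (‖z‖ ^ 2)) * μ (xs + z) - N z =
        (η (xs + z) * μ (xs + z) - (η xs * μ xs + MvPolynomial.eval (fun i => z i) b₁)) -
        p.eval (‖z‖ ^ 2) * (μ (xs + z) - (μ xs + MvPolynomial.eval (fun i => z i) b₂)) := by
      simp only [hN]; ring
    rw [e]
    refine (abs_sub _ _).trans ?_
    rw [abs_mul, add_mul, mul_assoc]
    exact add_le_add a1 (mul_le_mul hMz a2 (abs_nonneg _) hM0)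
  have hlow : ∀ z : Cov d, ‖z‖ ≤ R → ‖z‖ ^ β ≤ ‖z‖ ^ β * μ (xs + z) / l := by
    intro z hz
    rw [le_div_iff₀ hl]
    exact mul_le_mul_of_nonneg_left (hC1 _ (by simpa using hz)) (by positivity)
  have hgle : ∀ z : Cov d, ∀ x y : ℝ, (‖z‖ ≤ R → |x| ≤ y) → |g ‖z‖ * x| ≤ g ‖z‖ * y := by
    intro z x y h
    rw [abs_mul, abs_of_nonneg (hg0 _)]
    rcases le_or_gt ‖z‖ R with hz | hz
    · exact mul_le_mul_of_nonneg_left (h hz) (hg0 _)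
    · simp [hgR _ hz]
  have b1 : |∫ z : Cov d, g ‖z‖ * ((η (xs + z) - p.eval (‖z‖ ^ 2)) * μ (xs + z) - N z)| ≤
      (L₁ + M * L₂) / l * ∫ z : Cov d, g ‖z‖ * (‖z‖ ^ β * μ (xs + z)) := by
    rw [← integral_const_mul, ← Real.norm_eq_abs]
    refine norm_integral_le_of_norm_le (hpow_int.const_mul _) (Eventually.of_forall fun z => ?_)
    refine (hgle z _ ((L₁ + M * L₂) * (‖z‖ ^ β * μ (xs + z) / l)) fun hz => ?_).trans_eq ?_
    · exact (hpw z hz).trans (mul_le_mul_of_nonneg_left (hlow z hz) (by positivity))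
    · ring
  have b2 : |∫ z, g ‖z‖ * N z| ≤
      K / l * ∫ z : Cov d, g ‖z‖ * (‖z‖ ^ β * μ (xs + z)) := by
    rw [hN_eq, ← integral_const_mul, ← Real.norm_eq_abs]
    refine norm_integral_le_of_norm_le (hpow_int.const_mul _) (Eventually.of_forall fun z => ?_)
    refine (hgle z _ (K * (‖z‖ ^ β * μ (xs + z) / l)) fun hz => ?_).trans_eq ?_
    · exact (hdiff _ ⟨norm_nonneg z, hz⟩).trans (mul_le_mul_of_nonneg_left (hlow z hz) hK0)
    · ring
  have hsplit : ∫ z : Cov d, g ‖z‖ * ((η (xs + z) - p.eval (‖z‖ ^ 2)) * μ (xs + z)) =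
      (∫ z : Cov d, g ‖z‖ * ((η (xs + z) - p.eval (‖z‖ ^ 2)) * μ (xs + z) - N z)) +
        ∫ z, g ‖z‖ * N z := by
    simp only [mul_sub (g _)]
    rw [integral_sub hmain hN_int]
    ring
  rw [hsplit]
  refine (abs_add_le _ _).trans ((add_le_add b1 b2).trans_eq ?_)
  ring

/-- The `σ`-algebra generated by the distance of the covariate to the query. -/
noncomputable abbrev radiusSigma {d : ℕ} (xs : Cov d) : MeasurableSpace (Cov d × Fin 2) :=
  MeasurableSpace.comap (fun x => ‖x.1 - xs‖) inferInstance

theorem integral_mul_condExp_of_bound {Ω : Type*} {m m0 : MeasurableSpace Ω} {P : Measure Ω}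
    [IsFiniteMeasure P] (hm : m ≤ m0) {f g : Ω → ℝ} (hf : StronglyMeasurable[m] f)
    (hg : Integrable g P) {c : ℝ} (hc : ∀ x, |f x| ≤ c) :
    ∫ x, f x * (P[g | m]) x ∂P = ∫ x, f x * g x ∂P := by
  have h := condExp_stronglyMeasurable_mul_of_bound hm hf hg c (Eventually.of_forall hc)
  rw [← integral_condExp hm (f := fun x => f x * g x)]
  exact integral_congr_ae h.symm

/-! ### Regression of the label on the distance to the query -/

section

variable {d : ℕ} {Q : Measure (Cov d × Fin 2)} {μ η : Cov d → ℝ}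

theorem IsCovariateDensity.integral_eq (hμ : IsCovariateDensity Q μ) {f : Cov d → ℝ}
    (hf : Measurable f) : ∫ x, f x.1 ∂Q = ∫ y, f y * μ y := by
  rw [← integral_map measurable_fst.aemeasurable hf.aestronglyMeasurable, hμ.map_fst,
    integral_withDensity_eq_integral_toReal_smul hμ.measurable.ennreal_ofReal
      (Eventually.of_forall fun _ => ENNReal.ofReal_lt_top)]
  refine integral_congr_ae (Eventually.of_forall fun y => ?_)
  simp only [ENNReal.toReal_ofReal (hμ.nonneg y), smul_eq_mul, mul_comm]

theorem IsCovariateDensity.integrable [IsProbabilityMeasure Q] (hμ : IsCovariateDensity Q μ) :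
    Integrable μ := by
  have h : ∫⁻ y, ENNReal.ofReal (μ y) = 1 := by
    have := Measure.isProbabilityMeasure_map (μ := Q) measurable_fst.aemeasurable
    rw [← measure_univ (μ := Q.map Prod.fst), hμ.map_fst, withDensity_apply _ MeasurableSet.univ,
      Measure.restrict_univ]
  refine ⟨hμ.measurable.aestronglyMeasurable, ?_⟩
  rw [hasFiniteIntegral_iff_ofReal (Eventually.of_forall hμ.nonneg), h]
  exact ENNReal.one_lt_top

theorem IsCovariateDensity.ae_radius_ne (hd : 0 < d) (hμ : IsCovariateDensity Q μ) (xs : Cov d)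
    (c : ℝ) : ∀ᵐ x ∂Q, ‖x.1 - xs‖ ≠ c := by
  have : Nonempty (Fin d) := ⟨⟨0, hd⟩⟩
  have h1 : ∀ᵐ y ∂(volume : Measure (Cov d)), ‖y - xs‖ ≠ c := by
    rw [ae_iff]
    have : {y : Cov d | ¬ ‖y - xs‖ ≠ c} = Metric.sphere xs c := by
      ext y; simp
    rw [this]
    exact Measure.addHaar_sphere _ _ _
  have h2 : ∀ᵐ y ∂(Q.map Prod.fst), ‖y - xs‖ ≠ c := by
    rw [hμ.map_fst]
    exact (withDensity_absolutelyContinuous _ _).ae_le h1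
  exact ae_of_ae_map measurable_fst.aemeasurable h2

/-- Given the distance to the query, the label is regressed on an even polynomial in the distance,
up to a Hölder error. -/
theorem exists_radial_regression (hd : 0 < d) [IsProbabilityMeasure Q]
    (hμ : IsCovariateDensity Q μ) (hη : IsLabelProbability Q η) {xs : Cov d} {R β : ℝ}
    (hβ : 0 < β) (hR : 0 < R) (hR1 : R < 1)
    {l : ℝ} (hl : 0 < l) (hC1 : ∀ x ∈ Metric.closedBall xs R, l ≤ μ x)
    (hμH : IsHolderOnBall β R xs μ) (hημH : IsHolderOnBall β R xs (fun x => η x * μ x))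
    {w : ℕ} (hw : β ≤ 2 * (w + 1)) :
    ∃ (m : Cov d × Fin 2 → ℝ) (p : Polynomial ℝ) (C : ℝ), Measurable m ∧
      (∀ x, m x ∈ Set.Icc (0 : ℝ) 1) ∧ p.natDegree ≤ w ∧ p.eval 0 = η xs ∧ 0 ≤ C ∧
      (∀ (g : ℝ → ℝ) (M : ℝ), Measurable g → (∀ t, |g t| ≤ M) →
        ∫ x, g ‖x.1 - xs‖ * (((x.2 : ℕ) : ℝ) - m x) ∂Q = 0) ∧
      ∀ᵐ x ∂Q, ‖x.1 - xs‖ ≤ R → |m x - p.eval (‖x.1 - xs‖ ^ 2)| ≤ C * ‖x.1 - xs‖ ^ β := by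
  obtain ⟨p, C, hpdeg, hp0, hC, hbias⟩ := exists_polynomial_radial_bias hd hμ.integrable
    hη.measurable hη.mem_Icc hβ hR hR1 hl hC1 hμH hημH hw
  set ρ : Cov d × Fin 2 → ℝ := fun x => ‖x.1 - xs‖ with hρ
  have hρ_meas : Measurable ρ := by fun_prop
  have hρ_meas1 : Measurable[MeasurableSpace.comap Prod.fst inferInstance] ρ :=
    (by fun_prop : Measurable fun y : Cov d => ‖y - xs‖).comp (comap_measurable Prod.fst)
  have hρ_sigma : Measurable[radiusSigma xs] ρ := comap_measurable ρ
  have h_le : radiusSigma xs ≤ Prod.instMeasurableSpace := hρ_meas.comap_le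
  have hfst_le : MeasurableSpace.comap (Prod.fst : Cov d × Fin 2 → Cov d) inferInstance ≤
      Prod.instMeasurableSpace := measurable_fst.comap_le
  have hη1 : Measurable fun x : Cov d × Fin 2 => η x.1 := hη.measurable.comp measurable_fst
  have hη_int : Integrable (fun x : Cov d × Fin 2 => η x.1) Q :=
    Integrable.of_bound hη1.aestronglyMeasurable 1 (Eventually.of_forall fun x => by
      rw [Real.norm_of_nonneg (hη.mem_Icc _).1]; exact (hη.mem_Icc _).2)
  set m₀ : Cov d × Fin 2 → ℝ := Q[fun x : Cov d × Fin 2 => η x.1 | radiusSigma xs] with hm₀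
  have hm₀_meas : StronglyMeasurable[radiusSigma xs] m₀ := stronglyMeasurable_condExp
  have hm₀_nonneg : ∀ᵐ x ∂Q, 0 ≤ m₀ x :=
    condExp_nonneg (Eventually.of_forall fun x => (hη.mem_Icc _).1)
  have hm₀_le : ∀ᵐ x ∂Q, m₀ x ≤ 1 := by
    have := condExp_mono (m := radiusSigma xs) hη_int (integrable_const (1 : ℝ))
      (Eventually.of_forall fun x : Cov d × Fin 2 => (hη.mem_Icc x.1).2)
    rw [condExp_const h_le] at this
    exact this
  -- Clipping changes `m₀` on a null set only and makes the bounds hold everywhere.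
  set m : Cov d × Fin 2 → ℝ := fun x => max 0 (min 1 (m₀ x)) with hm
  have hm_meas : Measurable[radiusSigma xs] m := measurable_const.max (measurable_const.min hm₀_meas.measurable)
  have hm_eq : m =ᵐ[Q] m₀ := by
    filter_upwards [hm₀_nonneg, hm₀_le] with x h0 h1
    simp [hm, h0, h1]
  have hm_mem : ∀ x, m x ∈ Set.Icc (0 : ℝ) 1 := fun x =>
    ⟨le_max_left _ _, max_le zero_le_one (min_le_left _ _)⟩
  have hm_int : Integrable m Q := integrable_condExp.congr hm_eq.symm
  have hlab_meas : Measurable fun x : Cov d × Fin 2 => ((x.2 : ℕ) : ℝ) :=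
    (measurable_of_countable fun y : Fin 2 => ((y : ℕ) : ℝ)).comp measurable_snd
  have hlab_int : Integrable (fun x : Cov d × Fin 2 => ((x.2 : ℕ) : ℝ)) Q :=
    Integrable.of_bound hlab_meas.aestronglyMeasurable 1 (Eventually.of_forall fun x => by
      rw [Real.norm_of_nonneg (by positivity)]
      exact_mod_cast Nat.lt_succ_iff.mp x.2.2)
  have hlab_eq : (fun x : Cov d × Fin 2 => ((x.2 : ℕ) : ℝ)) =
      {x : Cov d × Fin 2 | x.2 = 1}.indicator fun _ => (1 : ℝ) := by
    funext x
    rcases x with ⟨x, y⟩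
    fin_cases y <;> simp
  have hm_proj : ∀ f : Cov d × Fin 2 → ℝ, Measurable[radiusSigma xs] f → ∀ M : ℝ, (∀ x, |f x| ≤ M) →
      ∫ x, f x * m x ∂Q = ∫ x, f x * η x.1 ∂Q := by
    intro f hf M hM
    rw [← integral_mul_condExp_of_bound h_le hf.stronglyMeasurable hη_int hM]
    refine integral_congr_ae ?_
    filter_upwards [hm_eq] with x hx
    rw [hx]
  refine ⟨m, p, C, hm_meas.mono h_le le_rfl, hm_mem, hpdeg, hp0, hC, ?_, ?_⟩
  · intro g M hg hM
    have i1 : Integrable (fun x => g (ρ x) * ((x.2 : ℕ) : ℝ)) Q :=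
      hlab_int.bdd_mul (hg.comp hρ_meas).aestronglyMeasurable (Eventually.of_forall fun x => hM _)
    have i2 : Integrable (fun x => g (ρ x) * m x) Q :=
      hm_int.bdd_mul (hg.comp hρ_meas).aestronglyMeasurable (Eventually.of_forall fun x => hM _)
    simp only [mul_sub]
    -- Tower property: a function of the distance has the same integral against `m`, against `η(X)`
    -- and against the label.
    rw [integral_sub i1 i2, hm_proj (fun x => g (ρ x)) (hg.comp hρ_sigma) M (fun x => hM _),
      ← integral_mul_condExp_of_bound hfst_le (f := fun x => g (ρ x)) (hg.comp hρ_meas1).stronglyMeasurable hlab_int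
        (fun x => hM _), sub_eq_zero]
    refine integral_congr_ae ?_
    filter_upwards [hη.ae_eq] with x hx
    rw [hx, hlab_eq]
  · obtain ⟨M, hM⟩ := isCompact_Icc.exists_bound_of_continuousOn
      (p.continuous.continuousOn (s := Set.Icc (0 : ℝ) 1))
    have hcut : Measurable fun t : ℝ => (Set.Icc (0 : ℝ) R).indicator (1 : ℝ → ℝ) t :=
      measurable_one.indicator measurableSet_Icc
    set u : Cov d × Fin 2 → ℝ := fun x =>
      (Set.Icc (0 : ℝ) R).indicator 1 (ρ x) * (m x - p.eval (ρ x ^ 2)) with hu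
    set v : Cov d × Fin 2 → ℝ := fun x =>
      (Set.Icc (0 : ℝ) R).indicator 1 (ρ x) * (C * ρ x ^ β) with hv
    have hu_meas : Measurable[radiusSigma xs] u := by
      refine (hcut.comp hρ_sigma).mul (hm_meas.sub ?_)
      exact p.continuous.measurable.comp (hρ_sigma.pow_const 2)
    have hv_meas : Measurable[radiusSigma xs] v :=
      (hcut.comp hρ_sigma).mul ((hρ_sigma.pow_const β).const_mul C)
    have hu_int : Integrable u Q := by
      refine Integrable.of_bound (hu_meas.mono h_le le_rfl).aestronglyMeasurable (1 + M)
        (Eventually.of_forall fun x => ?_)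
      have hM0 : 0 ≤ M := (norm_nonneg _).trans (hM 0 (by simp))
      by_cases hx : ρ x ∈ Set.Icc 0 R
      · simp only [hu, Set.indicator_of_mem hx, Pi.one_apply, one_mul]
        refine (norm_sub_le _ _).trans (add_le_add ?_ (hM _ ?_))
        · rw [Real.norm_of_nonneg (hm_mem x).1]; exact (hm_mem x).2
        · exact ⟨by positivity, pow_le_one₀ hx.1 (hx.2.trans hR1.le)⟩
      · simp only [hu, Set.indicator_of_notMem hx, zero_mul, norm_zero]
        positivity
    have hv_int : Integrable v Q := by
      refine Integrable.of_bound (hv_meas.mono h_le le_rfl).aestronglyMeasurable C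
        (Eventually.of_forall fun x => ?_)
      by_cases hx : ρ x ∈ Set.Icc 0 R
      · simp only [hv, Set.indicator_of_mem hx, Pi.one_apply, one_mul]
        rw [Real.norm_of_nonneg (mul_nonneg hC (Real.rpow_nonneg hx.1 _))]
        exact mul_le_of_le_one_right hC (Real.rpow_le_one hx.1 (hx.2.trans hR1.le) hβ.le)
      · simpa only [hv, Set.indicator_of_notMem hx, zero_mul, norm_zero] using hC
    -- A set of `radiusSigma xs` is a condition on the distance, so the integrated bias bound
    -- applies; functions measurable for this σ-algebra are then compared almost everywhere through
    -- their integrals over such sets.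
    have hset : ∀ s, MeasurableSet[radiusSigma xs] s →
        |∫ x in s, u x ∂Q| ≤ ∫ x in s, v x ∂Q := by
      rintro s ⟨T₀, hT₀, rfl⟩
      set T : Set ℝ := T₀ ∩ Set.Icc 0 R with hTdef
      have hT : MeasurableSet T := hT₀.inter measurableSet_Icc
      have hTind : Measurable (T.indicator (1 : ℝ → ℝ)) := measurable_one.indicator hT
      have hind : ∀ f : Cov d × Fin 2 → ℝ,
          ∫ x in ρ ⁻¹' T₀, (Set.Icc (0 : ℝ) R).indicator 1 (ρ x) * f x ∂Q =
            ∫ x, T.indicator 1 (ρ x) * f x ∂Q := by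
        intro f
        rw [← integral_indicator (hρ_meas hT₀)]
        refine integral_congr_ae (Eventually.of_forall fun x => ?_)
        by_cases h1 : ρ x ∈ T₀ <;> by_cases h2 : ρ x ∈ Set.Icc 0 R <;>
          simp [hTdef, Set.indicator, h1, h2]
      have hTb : ∀ t, |T.indicator (1 : ℝ → ℝ) t| ≤ 1 := fun t => by
        by_cases ht : t ∈ T <;> simp [ht]
      have hTp : Measurable fun t : ℝ => T.indicator 1 t * p.eval (t ^ 2) :=
        hTind.mul (p.continuous.measurable.comp (measurable_id.pow_const 2))
      have hTpb : ∀ t, |T.indicator 1 t * p.eval (t ^ 2)| ≤ M := fun t => by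
        by_cases ht : t ∈ T
        · simpa [ht] using hM (t ^ 2) ⟨by positivity, pow_le_one₀ ht.2.1 (ht.2.2.trans hR1.le)⟩
        · simpa [ht] using (norm_nonneg _).trans (hM 0 (by simp))
      have e1 : ∫ x in ρ ⁻¹' T₀, u x ∂Q =
          ∫ z : Cov d, T.indicator 1 ‖z‖ * ((η (xs + z) - p.eval (‖z‖ ^ 2)) * μ (xs + z)) := by
        have i1 : Integrable (fun x => T.indicator 1 (ρ x) * m x) Q :=
          hm_int.bdd_mul (hTind.comp hρ_meas).aestronglyMeasurable
            (Eventually.of_forall fun x => hTb _)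
        have i2 : Integrable (fun x => T.indicator 1 (ρ x) * η x.1) Q :=
          hη_int.bdd_mul (hTind.comp hρ_meas).aestronglyMeasurable
            (Eventually.of_forall fun x => hTb _)
        have i3 : Integrable (fun x => T.indicator 1 (ρ x) * p.eval (ρ x ^ 2)) Q :=
          Integrable.of_bound (hTp.comp hρ_meas).aestronglyMeasurable M
            (Eventually.of_forall fun x => hTpb _)
        rw [hind fun x => m x - p.eval (ρ x ^ 2)]
        simp only [mul_sub (T.indicator 1 (ρ _))]
        rw [integral_sub i1 i3, hm_proj (fun x => T.indicator 1 (ρ x)) (hTind.comp hρ_sigma) 1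
          (fun x => hTb _), ← integral_sub i2 i3]
        have := hμ.integral_eq (f := fun y => T.indicator 1 ‖y - xs‖ * η y -
          T.indicator 1 ‖y - xs‖ * p.eval (‖y - xs‖ ^ 2))
          (((hTind.comp (by fun_prop)).mul hη.measurable).sub (hTp.comp (by fun_prop)))
        rw [this, ← integral_add_left_eq_self _ xs]
        refine integral_congr_ae (Eventually.of_forall fun z => ?_)
        simp only [add_sub_cancel_left]
        ring
      have e2 : ∫ x in ρ ⁻¹' T₀, v x ∂Q =
          C * ∫ z : Cov d, T.indicator 1 ‖z‖ * (‖z‖ ^ β * μ (xs + z)) := by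
        rw [hind fun x => C * ρ x ^ β]
        have := hμ.integral_eq (f := fun y => T.indicator 1 ‖y - xs‖ * (C * ‖y - xs‖ ^ β))
          ((hTind.comp (by fun_prop)).mul (by fun_prop))
        rw [this, ← integral_add_left_eq_self _ xs, ← integral_const_mul]
        refine integral_congr_ae (Eventually.of_forall fun z => ?_)
        simp only [add_sub_cancel_left]
        ring
      rw [e1, e2]
      exact hbias T hT Set.inter_subset_right
    have hle : ∀ f : Cov d × Fin 2 → ℝ, Measurable[radiusSigma xs] f → Integrable f Q →
        (∀ s, MeasurableSet[radiusSigma xs] s → ∫ x in s, f x ∂Q ≤ ∫ x in s, v x ∂Q) → f ≤ᵐ[Q] v := by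
      intro f hf hf_int h
      refine ae_le_of_ae_le_trim (hm := h_le) ?_
      refine ae_le_of_forall_setIntegral_le (hf_int.trim h_le hf.stronglyMeasurable)
        (hv_int.trim h_le hv_meas.stronglyMeasurable) fun s hs _ => ?_
      rw [← setIntegral_trim h_le hf.stronglyMeasurable hs,
        ← setIntegral_trim h_le hv_meas.stronglyMeasurable hs]
      exact h s hs
    have h1 := hle u hu_meas hu_int fun s hs => (abs_le.mp (hset s hs)).2
    have h2 := hle (fun x => - u x) hu_meas.neg hu_int.neg fun s hs => by
      rw [integral_neg]
      linarith [(abs_le.mp (hset s hs)).1]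
    filter_upwards [h1, h2] with x hx1 hx2 hxR
    have hmem : ρ x ∈ Set.Icc 0 R := ⟨norm_nonneg _, hxR⟩
    simp only [hu, hv, Set.indicator_of_mem hmem, Pi.one_apply, one_mul] at hx1 hx2
    exact abs_le.mpr ⟨by linarith, hx1⟩

end

/-! ### Algebra of the regression weights -/

section Projection

variable {ι κ : Type*} [Fintype ι] [Fintype κ] [DecidableEq κ] (A : Matrix ι κ ℝ)

theorem projMatrix_transpose : (projMatrix A)ᵀ = projMatrix A := by
  simp only [projMatrix, Matrix.transpose_mul, Matrix.transpose_transpose,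
    Matrix.transpose_nonsing_inv, Matrix.mul_assoc]

/-- No rank assumption is needed: for a singular Gram matrix the inverse is `0`, and so is the
projection. -/
theorem projMatrix_mul_self : projMatrix A * projMatrix A = projMatrix A := by
  by_cases h : IsUnit (Aᵀ * A).det
  · calc projMatrix A * projMatrix A
        = A * ((Aᵀ * A)⁻¹ * (Aᵀ * A) * (Aᵀ * A)⁻¹) * Aᵀ := by
          simp only [projMatrix, Matrix.mul_assoc]
      _ = _ := by rw [Matrix.nonsing_inv_mul _ h, Matrix.one_mul, projMatrix]
  · simp [projMatrix, Matrix.nonsing_inv_apply_not_isUnit _ h]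

theorem transpose_mul_projMatrix (h : IsUnit (Aᵀ * A).det) : Aᵀ * projMatrix A = Aᵀ := by
  rw [projMatrix, ← Matrix.mul_assoc, ← Matrix.mul_assoc, Matrix.mul_nonsing_inv _ h,
    Matrix.one_mul]

theorem dotProduct_projMatrix_mulVec (e : ι → ℝ) :
    (projMatrix A *ᵥ e) ⬝ᵥ (projMatrix A *ᵥ e) = e ⬝ᵥ (projMatrix A *ᵥ e) := by
  nth_rw 1 [← projMatrix_transpose A]
  rw [Matrix.mulVec_transpose, ← Matrix.dotProduct_mulVec, Matrix.mulVec_mulVec,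
    projMatrix_mul_self]

/-- The right-hand side involves only `Aᵀ * A` and `Aᵀ *ᵥ e`, which zero rows do not affect. -/
theorem dotProduct_projMatrix_mulVec_eq (e : ι → ℝ) :
    e ⬝ᵥ (projMatrix A *ᵥ e) = (Aᵀ *ᵥ e) ⬝ᵥ ((Aᵀ * A)⁻¹ *ᵥ (Aᵀ *ᵥ e)) := by
  rw [projMatrix, ← Matrix.mulVec_mulVec, ← Matrix.mulVec_mulVec, Matrix.dotProduct_mulVec,
    ← Matrix.mulVec_transpose]

end Projection

/-! ### Regression weights as functions of the distances -/

noncomputable section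

variable {ι : Type*} (r : ℝ) (w : ℕ) (t : ι → ℝ)

/-- The indicator of the observations whose distance to the query is at most `r`. -/
def nearInd (i : ι) : ℝ := if t i ≤ r then 1 else 0

/-- The radial matrix over the whole sample, with zero rows outside of the ball. -/
def fullMatrix : Matrix ι (Fin w) ℝ :=
  Matrix.of fun i j => nearInd r t i * t i ^ (2 * ((j : ℕ) + 1))

theorem nearInd_mul_self (i : ι) : nearInd r t i * nearInd r t i = nearInd r t i := by
  unfold nearInd; split_ifs <;> simp

theorem nearInd_mem_Icc (i : ι) : nearInd r t i ∈ Set.Icc (0 : ℝ) 1 := by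
  unfold nearInd; split_ifs <;> simp

variable [Fintype ι]

/-- The number of the observations within distance `r`, as a function of the distances. -/
def nearCount : ℝ := ∑ i, nearInd r t i

/-- The projection statistic as a function of the distances. -/
def projStat : ℝ := nearInd r t ⬝ᵥ (projMatrix (fullMatrix r w t) *ᵥ nearInd r t)

/-- The residual of the constant regressor after projection onto the radial regressors. -/
def resid : ι → ℝ := nearInd r t - projMatrix (fullMatrix r w t) *ᵥ nearInd r t

open Classical in
/-- The weights with which the labels enter the truncated estimator. -/
def regWeight (φ : ℝ) (i : ι) : ℝ :=
  if (1 + w : ℝ) ≤ nearCount r t ∧ projStat r w t ≤ φ * nearCount r t then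
    resid r w t i / (nearCount r t - projStat r w t) else 0

theorem nearInd_dotProduct_self : nearInd r t ⬝ᵥ nearInd r t = nearCount r t := by
  simp only [dotProduct, nearInd_mul_self, nearCount]

theorem resid_dotProduct_nearInd :
    resid r w t ⬝ᵥ nearInd r t = nearCount r t - projStat r w t := by
  rw [resid, sub_dotProduct, nearInd_dotProduct_self, projStat, dotProduct_comm (_ *ᵥ _)]

/-- The residual is orthogonal to the projection, so its squared norm equals its product with the
constant regressor. This is the variance factor of the weights. -/
theorem resid_dotProduct_self :
    resid r w t ⬝ᵥ resid r w t = nearCount r t - projStat r w t := by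
  have h : resid r w t ⬝ᵥ (projMatrix (fullMatrix r w t) *ᵥ nearInd r t) = 0 := by
    rw [resid, sub_dotProduct, dotProduct_projMatrix_mulVec, sub_self]
  nth_rw 2 [resid]
  rw [dotProduct_sub, h, sub_zero, resid_dotProduct_nearInd]

/-- The coefficients of the projection of the constant regressor on the radial regressors. -/
def residCoeff : Fin w → ℝ :=
  ((fullMatrix r w t)ᵀ * fullMatrix r w t)⁻¹ *ᵥ ((fullMatrix r w t)ᵀ *ᵥ nearInd r t)

/-- Inside the ball the residual is an even polynomial in the distance with constant term one, hence
an admissible direction in which to perturb the fit. -/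
theorem resid_eq (i : ι) : resid r w t i =
    nearInd r t i * (1 - ∑ j, residCoeff r w t j * t i ^ (2 * ((j : ℕ) + 1))) := by
  have h : projMatrix (fullMatrix r w t) *ᵥ nearInd r t =
      fullMatrix r w t *ᵥ residCoeff r w t := by
    rw [projMatrix, ← Matrix.mulVec_mulVec, ← Matrix.mulVec_mulVec, residCoeff]
  rw [resid, Pi.sub_apply, h, mul_sub, mul_one, Finset.mul_sum]
  congr 1
  simp only [Matrix.mulVec, dotProduct, fullMatrix, Matrix.of_apply]
  exact Finset.sum_congr rfl fun j _ => by ring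

theorem nearInd_mul_resid (i : ι) : nearInd r t i * resid r w t i = resid r w t i := by
  rw [resid_eq, ← mul_assoc, nearInd_mul_self]

theorem sum_resid_mul_pow (h : IsUnit ((fullMatrix r w t)ᵀ * fullMatrix r w t).det) (j : Fin w) :
    ∑ i, resid r w t i * t i ^ (2 * ((j : ℕ) + 1)) = 0 := by
  have h1 : (fullMatrix r w t)ᵀ *ᵥ resid r w t = 0 := by
    rw [resid, Matrix.mulVec_sub, Matrix.mulVec_mulVec, transpose_mul_projMatrix _ h, sub_self]
  have h2 := congrFun h1 j
  simp only [Matrix.mulVec, dotProduct, fullMatrix, Matrix.of_apply, Matrix.transpose_apply,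
    Pi.zero_apply] at h2
  rw [← h2]
  refine Finset.sum_congr rfl fun i _ => ?_
  nth_rw 1 [← nearInd_mul_resid]
  ring

/-- The weights reproduce the value at zero of even polynomials. -/
theorem sum_resid_mul_evenPolynomial
    (h : IsUnit ((fullMatrix r w t)ᵀ * fullMatrix r w t).det) (θ : Fin (w + 1) → ℝ) :
    ∑ i, resid r w t i * ∑ c, θ c * t i ^ (2 * (c : ℕ)) =
      θ 0 * (nearCount r t - projStat r w t) := by
  have h1 : ∀ i, resid r w t i * ∑ c, θ c * t i ^ (2 * (c : ℕ)) =
      θ 0 * (resid r w t i * nearInd r t i) +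
        ∑ j : Fin w, θ j.succ * (resid r w t i * t i ^ (2 * ((j : ℕ) + 1))) := by
    intro i
    rw [Fin.sum_univ_succ, mul_add, Finset.mul_sum, mul_comm (resid r w t i) (nearInd r t i),
      nearInd_mul_resid]
    simp only [Fin.val_zero, mul_zero, pow_zero, mul_one, Fin.val_succ]
    congr 1
    · ring
    · exact Finset.sum_congr rfl fun j _ => by ring
  simp only [h1, Finset.sum_add_distrib, ← Finset.mul_sum]
  rw [Finset.sum_comm]
  simp only [← Finset.mul_sum, sum_resid_mul_pow r w t h, mul_zero, Finset.sum_const_zero, add_zero]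
  rw [← resid_dotProduct_nearInd, dotProduct]

/-- The Gram matrix of the radial regressors is regular when there are enough distinct positive
distances. -/
theorem isUnit_det_gram (hw : (w : ℝ) ≤ nearCount r t) (ht : ∀ i, 0 < t i)
    (hinj : Function.Injective t) :
    IsUnit ((fullMatrix r w t)ᵀ * fullMatrix r w t).det := by
  classical
  rw [isUnit_iff_ne_zero, ne_eq, ← Matrix.exists_mulVec_eq_zero_iff]
  rintro ⟨v, hv, hv0⟩
  have hA : fullMatrix r w t *ᵥ v = 0 := by
    rw [← Matrix.mulVec_mulVec] at hv0
    have := congrArg (fun u => v ⬝ᵥ u) hv0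
    simp only [dotProduct_zero] at this
    rw [Matrix.mulVec_transpose, dotProduct_comm, ← Matrix.dotProduct_mulVec] at this
    exact dotProduct_self_eq_zero.mp this
  -- For `v` in the kernel, each nearby row says `t² q(t²) = 0`. So `q`, of degree below `w`, has at
  -- least `w` distinct roots.
  set q : Polynomial ℝ := ∑ j : Fin w, Polynomial.C (v j) * Polynomial.X ^ (j : ℕ) with hq
  have hcoeff : ∀ j : Fin w, q.coeff j = v j := by
    intro j
    simp [hq, Polynomial.coeff_X_pow, Fin.val_inj]
  rcases Nat.eq_zero_or_pos w with h0 | hwpos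
  · subst h0
    exact hv (Subsingleton.elim _ _)
  have hdeg : q.natDegree < w := by
    rw [Nat.lt_iff_le_pred hwpos]
    refine Polynomial.natDegree_sum_le_of_forall_le _ _ fun j _ => ?_
    exact (Polynomial.natDegree_C_mul_X_pow_le _ _).trans (by have := j.2; omega)
  have hcard : ((Finset.univ.filter fun i => t i ≤ r).card : ℝ) = nearCount r t := by
    simp [nearCount, nearInd]
  have hq0 : q = 0 := by
    refine Polynomial.eq_zero_of_natDegree_lt_card_of_eval_eq_zero' q
      ((Finset.univ.filter fun i => t i ≤ r).image fun i => t i ^ 2) ?_ ?_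
    · intro s hs
      obtain ⟨i, hi, rfl⟩ := Finset.mem_image.mp hs
      have h1 := congrFun hA i
      simp only [Matrix.mulVec, dotProduct, fullMatrix, Matrix.of_apply, nearInd,
        (Finset.mem_filter.mp hi).2, if_true, one_mul, Pi.zero_apply] at h1
      have h2 : t i ^ 2 * q.eval (t i ^ 2) = 0 := by
        rw [← h1, hq, Polynomial.eval_finsetSum, Finset.mul_sum]
        refine Finset.sum_congr rfl fun j _ => ?_
        simp only [Polynomial.eval_mul, Polynomial.eval_C, Polynomial.eval_pow, Polynomial.eval_X]
        ring
      exact (mul_eq_zero.mp h2).resolve_left (pow_pos (ht i) 2).ne'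
    · rw [Finset.card_image_of_injective]
      · exact hdeg.trans_le (by exact_mod_cast hw.trans_eq hcard.symm)
      · intro i j hij
        exact hinj ((pow_left_inj₀ (ht i).le (ht j).le two_ne_zero).mp hij)
  refine hv (funext fun j => ?_)
  rw [← hcoeff j, hq0, Polynomial.coeff_zero, Pi.zero_apply]

end

/-! ### Measurability in the distances -/

theorem measurable_det {α κ : Type*} [MeasurableSpace α] [Fintype κ] [DecidableEq κ]
    {M : α → Matrix κ κ ℝ} (hM : ∀ i j, Measurable fun x => M x i j) :
    Measurable fun x => (M x).det := by
  simp only [Matrix.det_apply]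
  exact Finset.measurable_sum _ fun σ _ =>
    (Finset.measurable_prod _ fun i _ => hM _ _).const_smul _

theorem measurable_nonsing_inv {α κ : Type*} [MeasurableSpace α] [Fintype κ] [DecidableEq κ]
    {M : α → Matrix κ κ ℝ} (hM : ∀ i j, Measurable fun x => M x i j) (i j : κ) :
    Measurable fun x => (M x)⁻¹ i j := by
  simp only [Matrix.inv_def, Matrix.smul_apply, Ring.inverse_eq_inv', Matrix.adjugate_apply,
    smul_eq_mul]
  refine (measurable_det hM).inv.mul (measurable_det fun a b => ?_)
  by_cases h : a = j
  · subst h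
    simp only [Matrix.updateRow_self]
    exact measurable_const
  · simp only [Matrix.updateRow_ne h]
    exact hM _ _

section

variable {ι : Type*} (r : ℝ) (w : ℕ)

theorem measurable_nearInd (i : ι) : Measurable fun t : ι → ℝ => nearInd r t i :=
  Measurable.ite (measurableSet_le (measurable_pi_apply i) measurable_const)
    measurable_const measurable_const

theorem measurable_fullMatrix (i : ι) (j : Fin w) :
    Measurable fun t : ι → ℝ => fullMatrix r w t i j :=
  (measurable_nearInd r i).mul ((measurable_pi_apply i).pow_const _)

variable [Fintype ι]

theorem measurable_nearCount : Measurable fun t : ι → ℝ => nearCount r t :=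
  Finset.measurable_sum _ fun i _ => measurable_nearInd r i

theorem measurable_residCoeff (j : Fin w) : Measurable fun t : ι → ℝ => residCoeff r w t j := by
  simp only [residCoeff, Matrix.mulVec, dotProduct, Matrix.transpose_apply]
  refine Finset.measurable_sum _ fun k _ => (measurable_nonsing_inv (fun a b => ?_) _ _).mul
    (Finset.measurable_sum _ fun i _ => (measurable_fullMatrix r w i k).mul (measurable_nearInd r i))
  simp only [Matrix.mul_apply, Matrix.transpose_apply]
  exact Finset.measurable_sum _ fun i _ =>
    (measurable_fullMatrix r w i a).mul (measurable_fullMatrix r w i b)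

theorem measurable_resid (i : ι) : Measurable fun t : ι → ℝ => resid r w t i := by
  simp only [resid_eq]
  exact (measurable_nearInd r i).mul (measurable_const.sub (Finset.measurable_sum _ fun j _ =>
    (measurable_residCoeff r w j).mul ((measurable_pi_apply i).pow_const _)))

theorem measurable_projStat : Measurable fun t : ι → ℝ => projStat r w t := by
  have h : ∀ t : ι → ℝ, projStat r w t = nearCount r t - resid r w t ⬝ᵥ nearInd r t := fun t => by
    rw [resid_dotProduct_nearInd]; ring
  simp only [h, dotProduct]
  exact (measurable_nearCount r).sub (Finset.measurable_sum _ fun i _ =>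
    (measurable_resid r w i).mul (measurable_nearInd r i))

theorem measurable_regWeight (φ : ℝ) (i : ι) :
    Measurable fun t : ι → ℝ => regWeight r w t φ i := by
  classical
  refine Measurable.ite ?_ ((measurable_resid r w i).div
    ((measurable_nearCount r).sub (measurable_projStat r w))) measurable_const
  exact (measurableSet_le measurable_const (measurable_nearCount r)).inter
    (measurableSet_le (measurable_projStat r w) ((measurable_nearCount r).const_mul φ))

/-! ### Bounds on the weights -/

variable (t : ι → ℝ) {φ : ℝ}

theorem nearCount_nonneg : 0 ≤ nearCount r t :=
  Finset.sum_nonneg fun i _ => (nearInd_mem_Icc r t i).1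

theorem nearInd_mul_regWeight (i : ι) : nearInd r t i * regWeight r w t φ i =
    regWeight r w t φ i := by
  unfold regWeight
  split_ifs
  · rw [← mul_div_assoc, nearInd_mul_resid]
  · simp

/-- Normalizing the residual by its squared norm `N - ζ` leaves `1 / (N - ζ)`, and truncation gives
`N - ζ ≥ (1 - φ) N`. For `N = 0` both sides are zero. -/
theorem sum_regWeight_sq_le (hφ1 : φ < 1) :
    ∑ i, regWeight r w t φ i ^ 2 ≤ 1 / ((1 - φ) * nearCount r t) := by
  by_cases h : (1 + w : ℝ) ≤ nearCount r t ∧ projStat r w t ≤ φ * nearCount r t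
  · have hN : 0 < nearCount r t := lt_of_lt_of_le (by positivity) h.1
    have h1 : 0 < (1 - φ) * nearCount r t := mul_pos (by linarith) hN
    have h2 : (1 - φ) * nearCount r t ≤ nearCount r t - projStat r w t := by linarith [h.2]
    have h3 : ∑ i, regWeight r w t φ i ^ 2 = 1 / (nearCount r t - projStat r w t) := by
      have h4 := resid_dotProduct_self r w t
      simp only [dotProduct] at h4
      simp only [regWeight, if_pos h, div_pow, ← Finset.sum_div]
      simp only [sq (resid r w t _)]
      rw [h4]
      field_simp [(h1.trans_le h2).ne']
    rw [h3]
    exact one_div_le_one_div_of_le h1 h2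
  · simp only [regWeight, if_neg h]
    simpa using one_div_nonneg.mpr (mul_nonneg (by linarith : 0 ≤ 1 - φ) (nearCount_nonneg r t))

/-- Cauchy–Schwarz over the nearby observations: the count cancels against the `1 / N` in the sum of
squared weights. -/
theorem sq_sum_regWeight_mul_le (hφ1 : φ < 1) {y : ι → ℝ} {B : ℝ}
    (hy : ∀ i, t i ≤ r → |y i| ≤ B) :
    (∑ i, regWeight r w t φ i * y i) ^ 2 ≤ B ^ 2 / (1 - φ) := by
  have h1 : ∀ i, regWeight r w t φ i * y i = regWeight r w t φ i * (nearInd r t i * y i) :=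
    fun i => by
      nth_rw 1 [← nearInd_mul_regWeight]
      ring
  have h2 : ∀ i, (nearInd r t i * y i) ^ 2 ≤ nearInd r t i * B ^ 2 := by
    intro i
    unfold nearInd
    split_ifs with h
    · rw [one_mul, one_mul, ← sq_abs]
      gcongr
      exact hy i h
    · simp
  simp only [h1]
  calc (∑ i, regWeight r w t φ i * (nearInd r t i * y i)) ^ 2
      ≤ (∑ i, regWeight r w t φ i ^ 2) * ∑ i, (nearInd r t i * y i) ^ 2 :=
        Finset.sum_mul_sq_le_sq_mul_sq _ _ _
    _ ≤ 1 / ((1 - φ) * nearCount r t) * (nearCount r t * B ^ 2) := by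
        refine mul_le_mul (sum_regWeight_sq_le r w t hφ1) ?_ (by positivity) ?_
        · rw [nearCount, Finset.sum_mul]
          exact Finset.sum_le_sum fun i _ => h2 i
        · exact one_div_nonneg.mpr
            (mul_nonneg (by linarith) (nearCount_nonneg r t))
    _ ≤ B ^ 2 / (1 - φ) := by
        have h3 : 0 < 1 - φ := by linarith
        rcases (nearCount_nonneg r t).eq_or_lt with h0 | h0
        · rw [← h0]
          simp only [zero_mul, mul_zero]
          positivity
        · apply le_of_eq
          field_simp

theorem abs_regWeight_le (hφ1 : φ < 1) (i : ι) :
    |regWeight r w t φ i| ≤ √(1 / (1 - φ)) := by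
  classical
  have h := sq_sum_regWeight_mul_le r w t hφ1 (y := Pi.single i 1) (B := 1) fun j _ => by
    rw [Pi.single_apply]; split_ifs <;> simp
  rw [Finset.sum_eq_single i (by intro j _ hj; simp [hj]) (by simp)] at h
  simp only [Pi.single_eq_same, mul_one, one_pow] at h
  exact Real.abs_le_sqrt h

end

/-! ### The estimator as a weighted sum of the labels -/

section Estimator

variable {d n : ℕ} (xs : Cov d) (r : ℝ) (D : Fin n → Cov d × Fin 2)

theorem sum_nearby (f : Fin n → ℝ) :
    ∑ i : nearby xs r D, f i = ∑ i, nearInd r (radius xs D) i * f i := by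
  rw [Finset.sum_coe_sort (nearby xs r D) f, nearby, Finset.sum_filter]
  exact Finset.sum_congr rfl fun i _ => by unfold nearInd; split_ifs <;> simp

theorem numNearby_eq : (numNearby xs r D : ℝ) = nearCount r (radius xs D) := by
  have := sum_nearby xs r D fun _ => 1
  simpa [nearCount, numNearby] using this

theorem zeta_eq (w : ℕ) : zeta xs r D w = projStat r w (radius xs D) := by
  have hG : (radialMatrix xs r D w)ᵀ * radialMatrix xs r D w =
      (fullMatrix r w (radius xs D))ᵀ * fullMatrix r w (radius xs D) := by
    ext j k
    simp only [Matrix.mul_apply, Matrix.transpose_apply, radialMatrix, fullMatrix, Matrix.of_apply]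
    rw [sum_nearby xs r D fun i =>
      radius xs D i ^ (2 * ((j : ℕ) + 1)) * radius xs D i ^ (2 * ((k : ℕ) + 1))]
    refine Finset.sum_congr rfl fun i _ => ?_
    nth_rw 1 [← nearInd_mul_self]
    ring
  have hv : ((radialMatrix xs r D w)ᵀ *ᵥ fun _ => (1 : ℝ)) =
      (fullMatrix r w (radius xs D))ᵀ *ᵥ nearInd r (radius xs D) := by
    ext j
    simp only [Matrix.mulVec, dotProduct, Matrix.transpose_apply, radialMatrix, fullMatrix,
      Matrix.of_apply, mul_one]
    rw [sum_nearby xs r D fun i => radius xs D i ^ (2 * ((j : ℕ) + 1))]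
    refine Finset.sum_congr rfl fun i _ => ?_
    nth_rw 1 [← nearInd_mul_self]
    ring
  rw [zeta, projStat, dotProduct_projMatrix_mulVec_eq, dotProduct_projMatrix_mulVec_eq, hG, hv]

theorem goodEvent_iff (w : ℕ) (φ : ℝ) : goodEvent xs r D w φ ↔
    (1 + w : ℝ) ≤ nearCount r (radius xs D) ∧
      projStat r w (radius xs D) ≤ φ * nearCount r (radius xs D) := by
  rw [goodEvent, ← zeta_eq, ← numNearby_eq]
  norm_cast

/-- The normal equations of a weighted least squares problem. -/
theorem sum_mul_eq_zero_of_forall_le {ι : Type*} [Fintype ι] {a y k : ι → ℝ} (ha : ∀ i, 0 ≤ a i)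
    (h : ∀ s : ℝ, ∑ i, a i * y i ^ 2 ≤ ∑ i, a i * (y i - s * k i) ^ 2) :
    ∑ i, a i * y i * k i = 0 := by
  set B := ∑ i, a i * y i * k i with hB
  set K := ∑ i, a i * k i ^ 2 with hK
  have hK0 : 0 ≤ K := Finset.sum_nonneg fun i _ => mul_nonneg (ha i) (sq_nonneg _)
  have h1 : ∀ s : ℝ, 0 ≤ s ^ 2 * K - 2 * s * B := by
    intro s
    have e : ∑ i, a i * (y i - s * k i) ^ 2 =
        ∑ i, a i * y i ^ 2 + (s ^ 2 * K - 2 * s * B) := by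
      rw [hB, hK, Finset.mul_sum, Finset.mul_sum, ← Finset.sum_sub_distrib,
        ← Finset.sum_add_distrib]
      exact Finset.sum_congr rfl fun i _ => by ring
    have := h s
    rw [e] at this
    linarith
  -- At this `s` the quadratic is negative unless `B = 0`; the `+ 1` covers `K = 0`.
  have h2 := h1 (B / (K + 1))
  have e : (B / (K + 1)) ^ 2 * K - 2 * (B / (K + 1)) * B =
      -(B ^ 2 * (K + 2) / (K + 1) ^ 2) := by
    field_simp
    ring
  rw [e, neg_nonneg, div_nonpos_iff] at h2
  have h3 : 0 < (K + 1) ^ 2 := by positivity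
  have h4 : B ^ 2 * (K + 2) ≤ 0 := by
    rcases h2 with h2 | h2
    · exact absurd h2.2 (not_le.mpr h3)
    · exact h2.1
  nlinarith [sq_nonneg B]

/-- At distinct positive distances the estimator is a weighted sum of the labels. -/
theorem estimator_eq (w : ℕ) {φ : ℝ} (hφ1 : φ < 1) (hpos : ∀ i, 0 < radius xs D i)
    (hinj : Function.Injective (radius xs D)) :
    estimator xs r D w φ = ∑ i, regWeight r w (radius xs D) φ i * label D i := by
  classical
  set t := radius xs D with ht
  by_cases hg : goodEvent xs r D w φ
  swap
  · have h' := (goodEvent_iff xs r D w φ).not.mp hg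
    rw [← ht] at h'
    rw [estimator, if_neg hg]
    simp only [regWeight, if_neg h', zero_mul, Finset.sum_const_zero]
  have hg' := (goodEvent_iff xs r D w φ).mp hg
  rw [← ht] at hg'
  have hN : 0 < nearCount r t := lt_of_lt_of_le (by positivity) hg'.1
  have hpos' : 0 < nearCount r t - projStat r w t := by nlinarith [hg'.2]
  have hunit := isUnit_det_gram r w t (by linarith [hg'.1]) hpos hinj
  obtain ⟨⟨θ, hθ⟩, hmin⟩ := (exists_minimizer xs r D w).choose_spec
  change fitted xs r D w = _ at hθ
  change ∀ g ∈ evenPolynomials w, weightedLoss xs r D (fitted xs r D w) ≤ _ at hmin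
  -- The even polynomial with coefficients `κ` takes the residual's values at the nearby distances.
  -- Optimality in this direction makes labels and fitted values have the same residual-weighted
  -- sum, and for the fit this sum is `θ 0 * (N - ζ)`.
  set κ : Fin (w + 1) → ℝ := Fin.cons 1 fun j => - residCoeff r w t j with hκ
  have hκ_eval : ∀ s : ℝ, ∑ c, κ c * s ^ (2 * (c : ℕ)) =
      1 - ∑ j, residCoeff r w t j * s ^ (2 * ((j : ℕ) + 1)) := by
    intro s
    rw [Fin.sum_univ_succ]
    simp [hκ, sub_eq_add_neg]
  have hbox : ∀ i, boxcarWeight r (numNearby xs r D) (t i) = nearInd r t i / nearCount r t := by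
    intro i
    rw [boxcarWeight, numNearby_eq, ← ht, nearInd]
    split_ifs <;> simp
  have hnormal : ∑ i, boxcarWeight r (numNearby xs r D) (t i) *
      (label D i - fitted xs r D w (t i)) * (∑ c, κ c * t i ^ (2 * (c : ℕ))) = 0 := by
    refine sum_mul_eq_zero_of_forall_le (fun i => boxcarWeight_nonneg _ _ _) fun s => ?_
    have := hmin (fun x => ∑ c, (θ c + s * κ c) * x ^ (2 * (c : ℕ))) ⟨_, rfl⟩
    refine this.trans_eq (Finset.sum_congr rfl fun i _ => ?_)
    rw [hθ]
    simp only [add_mul, Finset.sum_add_distrib, mul_assoc, ← Finset.mul_sum]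
    congr 2
    rw [← ht]
    ring
  have hresid : ∑ i, resid r w t i * (label D i - fitted xs r D w (t i)) = 0 := by
    have h1 : ∀ i, resid r w t i * (label D i - fitted xs r D w (t i)) = nearCount r t *
        (boxcarWeight r (numNearby xs r D) (t i) *
          (label D i - fitted xs r D w (t i)) * (∑ c, κ c * t i ^ (2 * (c : ℕ)))) := by
      intro i
      rw [resid_eq, hbox, hκ_eval]
      field_simp
    simp only [h1, ← Finset.mul_sum, hnormal, mul_zero]
  have hfit0 : fitted xs r D w 0 = θ 0 := by
    simp [hθ, Fin.sum_univ_succ]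
  simp only [mul_sub, Finset.sum_sub_distrib] at hresid
  rw [hθ, sum_resid_mul_evenPolynomial r w t hunit, sub_eq_zero] at hresid
  rw [estimator, if_pos hg, hfit0]
  simp only [regWeight, if_pos hg', div_mul_eq_mul_div, ← Finset.sum_div]
  rw [hresid, mul_div_cancel_right₀ _ hpos'.ne']

end Estimator

/-! ### Probabilistic estimates -/

section Product

variable {α : Type*} [MeasurableSpace α] {P : Measure α} [IsProbabilityMeasure P]

/-- Fubini's theorem in one coordinate of a product of copies of a probability measure. -/
theorem integral_pi_eq_zero_of_update {n : ℕ} (i : Fin n) {F : (Fin n → α) → ℝ}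
    (hF : Integrable F (Measure.pi fun _ => P))
    (h : ∀ D, ∫ x, F (Function.update D i x) ∂P = 0) :
    ∫ D, F D ∂(Measure.pi fun _ => P) = 0 := by
  obtain ⟨k, rfl⟩ : ∃ k, n = k + 1 := ⟨n - 1, by have := i.2; omega⟩
  have hmp := (measurePreserving_piFinSuccAbove (fun _ : Fin (k + 1) => P) i).symm
  have hint : Integrable (fun p : α × (Fin k → α) =>
      F ((MeasurableEquiv.piFinSuccAbove (fun _ => α) i).symm p))
      (P.prod (Measure.pi fun _ => P)) :=
    (hmp.integrable_comp_emb (MeasurableEquiv.measurableEmbedding _)).mpr hF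
  rw [← hmp.integral_comp' F, integral_prod_symm _ hint]
  -- An arbitrary entry, overwritten by the update.
  obtain ⟨x₀⟩ : Nonempty α := P.nonempty_of_neZero
  refine integral_eq_zero_of_ae (Eventually.of_forall fun y => ?_)
  rw [Pi.zero_apply, ← h (Fin.insertNth i x₀ y)]
  refine integral_congr_ae (Eventually.of_forall fun x => ?_)
  simp only [Fin.update_insertNth]
  rfl

/-- Two coordinates have law `P.prod P`; for a fixed first one, the second avoids its value of `ρ`
almost surely. -/
theorem ae_pi_ne {n : ℕ} {ρ : α → ℝ} (hρ : Measurable ρ) (h : ∀ c, ∀ᵐ x ∂P, ρ x ≠ c)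
    {i j : Fin n} (hij : i ≠ j) : ∀ᵐ D ∂(Measure.pi fun _ : Fin n => P), ρ (D i) ≠ ρ (D j) := by
  have hind : (fun D : Fin n → α => D i) ⟂ᵢ[Measure.pi fun _ => P] fun D => D j :=
    (iIndepFun_pi (μ := fun _ : Fin n => P) (X := fun _ x => x)
      fun _ => aemeasurable_id).indepFun hij
  have hlaw := hind.map_prod_eq_prod_map_map (measurable_pi_apply i).aemeasurable
    (measurable_pi_apply j).aemeasurable
  have hev : ∀ k : Fin n, (Measure.pi fun _ : Fin n => P).map (fun D => D k) = P := fun k =>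
    (measurePreserving_eval (fun _ => P) k).map_eq
  rw [hev, hev] at hlaw
  have hs : MeasurableSet {p : α × α | ρ p.1 = ρ p.2} :=
    measurableSet_eq_fun (hρ.comp measurable_fst) (hρ.comp measurable_snd)
  have hnull : (P.prod P) {p : α × α | ρ p.1 = ρ p.2} = 0 := by
    rw [Measure.measure_prod_null hs]
    refine Eventually.of_forall fun x => ?_
    have := h (ρ x)
    rw [ae_iff] at this
    simpa [eq_comm, Set.preimage] using this
  rw [← hlaw, Measure.map_apply (by fun_prop) hs] at hnull
  rw [ae_iff]
  simpa [Set.preimage] using hnull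

/-- A weighted sum of independent errors that are centered given the covariate `ρ`, with weights
depending on the values of `ρ`, has no cross terms in its second moment. -/
theorem integral_sq_sum_mul_eq {n : ℕ} {ρ : α → ℝ} (hρ : Measurable ρ) {ξ : α → ℝ}
    (hξ : Measurable ξ) (hξ1 : ∀ x, |ξ x| ≤ 1)
    (horth : ∀ (g : ℝ → ℝ) (M : ℝ), Measurable g → (∀ s, |g s| ≤ M) → ∫ x, g (ρ x) * ξ x ∂P = 0)
    {W : (Fin n → ℝ) → Fin n → ℝ} (hW : ∀ i, Measurable fun t => W t i) {B : ℝ}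
    (hWB : ∀ t i, |W t i| ≤ B) :
    ∫ D, (∑ i, W (fun k => ρ (D k)) i * ξ (D i)) ^ 2 ∂(Measure.pi fun _ => P) =
      ∑ i, ∫ D, (W (fun k => ρ (D k)) i * ξ (D i)) ^ 2 ∂(Measure.pi fun _ => P) := by
  have hmeas : ∀ i, Measurable fun D : Fin n → α => W (fun k => ρ (D k)) i * ξ (D i) := fun i =>
    ((hW i).comp (measurable_pi_lambda _ fun k => hρ.comp (measurable_pi_apply k))).mul
      (hξ.comp (measurable_pi_apply i))
  have hB : ∀ i (D : Fin n → α), |W (fun k => ρ (D k)) i * ξ (D i)| ≤ B := fun i D => by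
    rw [abs_mul]
    have hB0 := (abs_nonneg _).trans (hWB (fun k => ρ (D k)) i)
    simpa using mul_le_mul (hWB _ i) (hξ1 (D i)) (abs_nonneg _) hB0
  have hint : ∀ i j, Integrable (fun D : Fin n → α => (W (fun k => ρ (D k)) i * ξ (D i)) *
      (W (fun k => ρ (D k)) j * ξ (D j))) (Measure.pi fun _ => P) := fun i j => by
    refine Integrable.of_bound ((hmeas i).mul (hmeas j)).aestronglyMeasurable (B * B)
      (Eventually.of_forall fun D => ?_)
    rw [norm_mul]
    exact mul_le_mul (hB i D) (hB j D) (norm_nonneg _) ((abs_nonneg _).trans (hB i D))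
  simp only [sq, Finset.sum_mul_sum]
  rw [integral_finsetSum _ fun i _ => integrable_finsetSum _ fun j _ => hint i j]
  refine Finset.sum_congr rfl fun i _ => ?_
  rw [integral_finsetSum _ fun j _ => hint i j]
  refine Finset.sum_eq_single i (fun j _ hji => ?_) (by simp)
  -- With all observations but the `i`-th frozen, `ξ (D j)` is constant and the product of the two
  -- weights is a bounded function of `ρ` at the `i`-th one, so `horth` applies.
  refine integral_pi_eq_zero_of_update i (hint i j) fun D => ?_
  have hup : ∀ x, (fun k => ρ (Function.update D i x k)) =
      Function.update (fun k => ρ (D k)) i (ρ x) := fun x => by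
    funext k
    rcases eq_or_ne k i with rfl | hk
    · simp
    · simp [hk]
  have hupm : Measurable fun s : ℝ => Function.update (fun k => ρ (D k)) i s :=
    measurable_update _
  have := horth (fun s => W (Function.update (fun k => ρ (D k)) i s) i *
    W (Function.update (fun k => ρ (D k)) i s) j) (B * B)
    (((hW i).comp hupm).mul ((hW j).comp hupm)) fun s => by
      rw [abs_mul]
      exact mul_le_mul (hWB _ i) (hWB _ j) (abs_nonneg _) ((abs_nonneg _).trans (hWB 0 i))
  rw [← mul_zero (ξ (D j)), ← this, ← integral_const_mul]
  refine integral_congr_ae (Eventually.of_forall fun x => ?_)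
  simp only [hup, Function.update_self, Function.update_of_ne hji]
  ring

end Product

/-! ### The number of nearby observations -/

section Count

variable {d : ℕ} {Q : Measure (Cov d × Fin 2)} [IsProbabilityMeasure Q] (xs : Cov d)

theorem measurable_radius (d : ℕ) (xs : Cov d) :
    Measurable fun x : Cov d × Fin 2 => ‖x.1 - xs‖ := by fun_prop

theorem measurable_radius_sample {n : ℕ} :
    Measurable fun D : Fin n → Cov d × Fin 2 => radius xs D :=
  measurable_pi_lambda _ fun i => (measurable_radius d xs).comp (measurable_pi_apply i)

/-- The number of nearby observations has at most its mean as variance. -/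
theorem integral_sq_nearCount_sub_le (n : ℕ) (r : ℝ) :
    ∫ D : Fin n → Cov d × Fin 2,
        (nearCount r (radius xs D) - n * Q.real {x | ‖x.1 - xs‖ ≤ r}) ^ 2 ∂(sampleLaw Q n) ≤
      n * Q.real {x | ‖x.1 - xs‖ ≤ r} := by
  set S : Set (Cov d × Fin 2) := {x | ‖x.1 - xs‖ ≤ r} with hS
  have hSm : MeasurableSet S := measurableSet_le (measurable_radius d xs) measurable_const
  set X : Cov d × Fin 2 → ℝ := S.indicator 1 with hX
  have hXm : Measurable X := measurable_one.indicator hSm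
  have hX_int : ∫ x, X x ∂Q = Q.real S := integral_indicator_one hSm
  have hX2 : X ^ 2 = X := by
    funext x
    by_cases h : x ∈ S <;> simp [hX, h]
  have hXL : MemLp X 2 Q := memLp_of_bounded (a := 0) (b := 1)
    (Eventually.of_forall fun x => by by_cases h : x ∈ S <;> simp [hX, h]) hXm.aestronglyMeasurable 2
  have hvar : Var[X; Q] ≤ Q.real S := by
    refine (variance_le_expectation_sq hXm.aestronglyMeasurable).trans_eq ?_
    rw [hX2, hX_int]
  have hcount : ∀ D : Fin n → Cov d × Fin 2,
      nearCount r (radius xs D) = (∑ i, fun ω : Fin n → Cov d × Fin 2 => X (ω i)) D := fun D => by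
    rw [Finset.sum_apply, nearCount]
    refine Finset.sum_congr rfl fun i _ => ?_
    by_cases h : radius xs D i ≤ r
    · have h' : D i ∈ S := h
      rw [nearInd, if_pos h, hX, Set.indicator_of_mem h', Pi.one_apply]
    · have h' : D i ∉ S := h
      rw [nearInd, if_neg h, hX, Set.indicator_of_notMem h']
  have hmean : ∫ D, (∑ i, fun ω : Fin n → Cov d × Fin 2 => X (ω i)) D ∂(sampleLaw Q n) =
      n * Q.real S := by
    simp only [Finset.sum_apply]
    rw [integral_finsetSum]
    · have : ∀ i : Fin n, ∫ D : Fin n → Cov d × Fin 2, X (D i) ∂(sampleLaw Q n) = Q.real S := by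
        intro i
        rw [← hX_int]
        have hmp := measurePreserving_eval (fun _ : Fin n => Q) i
        conv_rhs => rw [← hmp.map_eq]
        exact (integral_map hmp.measurable.aemeasurable hXm.aestronglyMeasurable).symm
      simp [this]
    · intro i _
      exact (measurePreserving_eval (fun _ : Fin n => Q) i).integrable_comp_of_integrable
        (hXL.integrable one_le_two)
  have hsum := variance_sum_pi (ι := Fin n) (μ := fun _ => Q) (X := fun _ => X) fun _ => hXL
  rw [variance_eq_integral (Measurable.aemeasurable (by fun_prop))] at hsum
  change ∫ D, ((∑ i, fun ω : Fin n → Cov d × Fin 2 => X (ω i)) D -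
    ∫ D, (∑ i, fun ω : Fin n → Cov d × Fin 2 => X (ω i)) D ∂(sampleLaw Q n)) ^ 2
      ∂(sampleLaw Q n) = _ at hsum
  rw [hmean] at hsum
  simp only [hcount]
  rw [hsum, Finset.sum_const, Finset.card_univ, Fintype.card_fin, nsmul_eq_mul]
  exact mul_le_mul_of_nonneg_left hvar (Nat.cast_nonneg n)

/-- A lower bound for the mass of small balls. -/
theorem mul_pow_le_measure_radius_le {μ : Cov d → ℝ} (hμ : IsCovariateDensity Q μ) {R l : ℝ}
    (hC1 : ∀ x ∈ Metric.closedBall xs R, l ≤ μ x) {r : ℝ} (hr : 0 ≤ r) (hrR : r ≤ R) :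
    l * (volume : Measure (Cov d)).real (Metric.ball 0 1) * r ^ d ≤
      Q.real {x | ‖x.1 - xs‖ ≤ r} := by
  have hball : MeasurableSet (Metric.closedBall xs r) := Metric.isClosed_closedBall.measurableSet
  have h1 : Q.real {x | ‖x.1 - xs‖ ≤ r} = ∫ y in Metric.closedBall xs r, μ y := by
    have h2 := hμ.integral_eq (f := (Metric.closedBall xs r).indicator 1)
      (measurable_one.indicator hball)
    have h3 : {x : Cov d × Fin 2 | ‖x.1 - xs‖ ≤ r} = Prod.fst ⁻¹' Metric.closedBall xs r := by
      ext x; simp [dist_eq_norm]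
    rw [h3, ← integral_indicator_one (measurable_fst hball), ← integral_indicator hball]
    refine h2.trans (integral_congr_ae (Eventually.of_forall fun y => ?_))
    by_cases hy : y ∈ Metric.closedBall xs r <;> simp [Set.indicator, hy]
  rw [h1]
  have h4 : ∫ _ in Metric.closedBall xs r, l ∂(volume : Measure (Cov d)) ≤
      ∫ y in Metric.closedBall xs r, μ y := by
    refine setIntegral_mono_on ?_ hμ.integrable.integrableOn hball fun y hy =>
      hC1 y (Metric.closedBall_subset_closedBall hrR hy)
    exact integrableOn_const (isCompact_closedBall xs r).measure_lt_top.ne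
  refine le_trans (le_of_eq ?_) h4
  rw [setIntegral_const, Measure.addHaar_real_closedBall _ _ hr, finrank_euclideanSpace_fin,
    smul_eq_mul]
  ring

end Count

/-- A stretched exponential decays faster than the reciprocal. -/
theorem exists_exp_neg_mul_rpow_le {c τ : ℝ} (hc : 0 < c) (hτ : 0 < τ) :
    ∃ K : ℝ, 0 < K ∧ ∀ n : ℕ, 1 ≤ n → Real.exp (-c * (n : ℝ) ^ τ) ≤ K / n := by
  -- This `k` gives `n ≤ (n ^ τ) ^ k`, to be used with `x ^ k / k! ≤ exp x`.
  obtain ⟨k, hk⟩ := exists_nat_ge (1 / τ)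
  refine ⟨k.factorial / c ^ k, by positivity, fun n hn => ?_⟩
  have hn1 : (1 : ℝ) ≤ n := by exact_mod_cast hn
  have hn0 : (0 : ℝ) < n := by linarith
  have h1 := Real.pow_div_factorial_le_exp (x := c * (n : ℝ) ^ τ) (by positivity) k
  have h2 : (n : ℝ) ≤ ((n : ℝ) ^ τ) ^ k := by
    rw [← Real.rpow_natCast, ← Real.rpow_mul hn0.le]
    nth_rw 1 [← Real.rpow_one (n : ℝ)]
    refine Real.rpow_le_rpow_of_exponent_le hn1 ?_
    rw [div_le_iff₀ hτ] at hk
    linarith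
  rw [neg_mul, Real.exp_neg, div_div]
  refine inv_le_of_inv_le₀ (by positivity) ?_
  refine le_trans ?_ h1
  rw [inv_div, mul_pow]
  gcongr

/-- A pointwise Chebyshev bound: either `N ≥ t / 2`, or `(N - t)²` exceeds `t² / 4`. The value `N =
0` is harmless since `1 / 0 = 0`. With mean `t` and variance at most `t`, integration gives `6 / t`.
-/
theorem one_div_le_of_sq_sub {N t : ℝ} (ht : 0 < t) (hN : N = 0 ∨ 1 ≤ N) :
    1 / N ≤ 2 / t + 4 / t ^ 2 * (N - t) ^ 2 := by
  rcases hN with rfl | hN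
  · simp only [div_zero]; positivity
  rcases le_or_gt (t / 2) N with h | h
  · have h1 : 1 / N ≤ 2 / t := by
      rw [div_le_div_iff₀ (by linarith) ht]; linarith
    have h2 : 0 ≤ 4 / t ^ 2 * (N - t) ^ 2 := by positivity
    linarith
  · have h1 : 1 / N ≤ 1 := by rw [div_le_one (by linarith)]; exact hN
    have h2 : 1 ≤ 4 / t ^ 2 * (N - t) ^ 2 := by
      rw [div_mul_eq_mul_div, one_le_div (by positivity)]
      nlinarith
    have h3 : 0 ≤ 2 / t := by positivity
    linarith

/-- The same dichotomy, for the event of having at most `b` neighbours. -/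
theorem one_le_of_sq_sub {N t b : ℝ} (ht : 0 < t) (hb : 0 ≤ b) (hN : N ≤ b) :
    1 ≤ 2 * b / t + 4 / t ^ 2 * (N - t) ^ 2 := by
  rcases le_or_gt (t / 2) N with h | h
  · have h1 : 1 ≤ 2 * b / t := by
      rw [one_le_div ht]; linarith
    have h2 : 0 ≤ 4 / t ^ 2 * (N - t) ^ 2 := by positivity
    linarith
  · have h2 : 1 ≤ 4 / t ^ 2 * (N - t) ^ 2 := by
      rw [div_mul_eq_mul_div, one_le_div (by positivity)]
      nlinarith
    have h3 : 0 ≤ 2 * b / t := by positivity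
    linarith

/-! ### Risk of the estimator -/

section Risk

variable {d n : ℕ} {Q : Measure (Cov d × Fin 2)} [IsProbabilityMeasure Q]

instance : IsProbabilityMeasure (sampleLaw Q n) := by unfold sampleLaw; infer_instance

theorem label_mem_Icc (D : Fin n → Cov d × Fin 2) (i : Fin n) :
    label D i ∈ Set.Icc (0 : ℝ) 1 :=
  ⟨by unfold label; positivity, by
    unfold label; exact_mod_cast Nat.lt_succ_iff.mp (D i).2.2⟩

theorem measurable_label (i : Fin n) : Measurable fun D : Fin n → Cov d × Fin 2 => label D i :=
  (measurable_of_countable fun y : Fin 2 => ((y : ℕ) : ℝ)).comp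
    (measurable_snd.comp (measurable_pi_apply i))

theorem measurable_weightedSum (xs : Cov d) (r : ℝ) (w : ℕ) (φ : ℝ) :
    Measurable fun D : Fin n → Cov d × Fin 2 =>
      ∑ i, regWeight r w (radius xs D) φ i * label D i :=
  Finset.measurable_sum _ fun i _ =>
    ((measurable_regWeight r w φ i).comp (measurable_radius_sample xs)).mul (measurable_label i)

theorem ae_radius_pos_and_injective (hd : 0 < d) {μ : Cov d → ℝ} (hμ : IsCovariateDensity Q μ)
    (xs : Cov d) : ∀ᵐ D ∂(sampleLaw Q n), (∀ i, 0 < radius xs D i) ∧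
      Function.Injective (radius xs D) := by
  have h1 : ∀ᵐ D ∂(sampleLaw Q n), ∀ i, ‖(D i).1 - xs‖ ≠ 0 :=
    ae_all_iff.mpr fun i => (Measure.tendsto_eval_ae_ae (μ := fun _ : Fin n => Q)
      (i := i)).eventually (hμ.ae_radius_ne hd xs 0)
  have h2 : ∀ᵐ D ∂(sampleLaw Q n), ∀ i j : Fin n, i ≠ j →
      ‖(D i).1 - xs‖ ≠ ‖(D j).1 - xs‖ :=
    ae_all_iff.mpr fun i => ae_all_iff.mpr fun j => eventually_imp_distrib_left.mpr fun hij =>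
      ae_pi_ne (measurable_radius d xs) (hμ.ae_radius_ne hd xs) hij
  filter_upwards [h1, h2] with D hD1 hD2
  refine ⟨fun i => lt_of_le_of_ne (norm_nonneg _) (hD1 i).symm, fun i j hij => ?_⟩
  by_contra h
  exact hD2 i j h hij

/-- Almost surely the squared error is that of a weighted sum of the labels. -/
theorem sq_error_ae_eq (hd : 0 < d) {μ : Cov d → ℝ} (hμ : IsCovariateDensity Q μ) (xs : Cov d)
    (r : ℝ) (w : ℕ) {φ : ℝ} (hφ1 : φ < 1) (a : ℝ) :
    (fun D : Fin n → Cov d × Fin 2 => (a - estimator xs r D w φ) ^ 2) =ᵐ[sampleLaw Q n]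
      fun D => (a - ∑ i, regWeight r w (radius xs D) φ i * label D i) ^ 2 := by
  filter_upwards [ae_radius_pos_and_injective hd hμ xs] with D hD
  rw [estimator_eq xs r D w hφ1 hD.1 hD.2]

/-- A crude bound uniform in the sample, used for integrability and for radii larger than `R`. -/
theorem sq_weightedSum_error_le (xs : Cov d) (r : ℝ) (w : ℕ) {φ : ℝ} (hφ1 : φ < 1) {a : ℝ}
    (ha : a ∈ Set.Icc (0 : ℝ) 1) (D : Fin n → Cov d × Fin 2) :
    (a - ∑ i, regWeight r w (radius xs D) φ i * label D i) ^ 2 ≤ 2 + 2 / (1 - φ) := by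
  have h1 := sq_sum_regWeight_mul_le r w (radius xs D) hφ1 (y := label D) (B := 1)
    fun i _ => abs_le.mpr ⟨by linarith [(label_mem_Icc D i).1], (label_mem_Icc D i).2⟩
  have h2 : a ^ 2 ≤ 1 := pow_le_one₀ ha.1 ha.2
  have h3 : 2 / (1 - φ) = 2 * (1 ^ 2 / (1 - φ)) := by ring
  rw [h3]
  nlinarith [sq_nonneg (a + ∑ i, regWeight r w (radius xs D) φ i * label D i)]

theorem integrable_sq_weightedSum_error (xs : Cov d) (r : ℝ) (w : ℕ) {φ : ℝ} (hφ1 : φ < 1)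
    {a : ℝ} (ha : a ∈ Set.Icc (0 : ℝ) 1) :
    Integrable (fun D : Fin n → Cov d × Fin 2 =>
      (a - ∑ i, regWeight r w (radius xs D) φ i * label D i) ^ 2) (sampleLaw Q n) :=
  Integrable.of_bound
    ((measurable_const.sub (measurable_weightedSum xs r w φ)).pow_const 2).aestronglyMeasurable
    (2 + 2 / (1 - φ)) (Eventually.of_forall fun D => by
      rw [Real.norm_of_nonneg (sq_nonneg _)]
      exact sq_weightedSum_error_le xs r w hφ1 ha D)

theorem nearCount_eq_zero_or_one_le (xs : Cov d) (r : ℝ) (D : Fin n → Cov d × Fin 2) :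
    nearCount r (radius xs D) = 0 ∨ 1 ≤ nearCount r (radius xs D) := by
  rw [← numNearby_eq]
  rcases Nat.eq_zero_or_pos (numNearby xs r D) with h | h
  · left; exact_mod_cast h
  · right; exact_mod_cast h

theorem integrable_sq_nearCount_sub (xs : Cov d) (r s : ℝ) :
    Integrable (fun D : Fin n → Cov d × Fin 2 => (nearCount r (radius xs D) - s) ^ 2)
      (sampleLaw Q n) := by
  refine Integrable.of_bound ((((measurable_nearCount r).comp
    (measurable_radius_sample xs)).sub_const s).pow_const 2).aestronglyMeasurable
    ((n + |s|) ^ 2) (Eventually.of_forall fun D => ?_)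
  have h1 : nearCount r (radius xs D) ≤ n := by
    refine (Finset.sum_le_sum fun i _ => (nearInd_mem_Icc r (radius xs D) i).2).trans_eq ?_
    simp
  rw [Real.norm_of_nonneg (sq_nonneg _), ← sq_abs]
  refine pow_le_pow_left₀ (abs_nonneg _) ((abs_sub _ _).trans ?_) 2
  rw [abs_of_nonneg (nearCount_nonneg r _)]
  linarith

/-- The stochastic error of the weighted sum of the labels. -/
theorem integral_sq_stochastic_error_le (xs : Cov d) (r : ℝ) (w : ℕ) {φ : ℝ} (hφ1 : φ < 1)
    {ξ : Cov d × Fin 2 → ℝ} (hξ : Measurable ξ) (hξ1 : ∀ x, |ξ x| ≤ 1)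
    (horth : ∀ (g : ℝ → ℝ) (M : ℝ), Measurable g → (∀ s, |g s| ≤ M) →
      ∫ x, g ‖x.1 - xs‖ * ξ x ∂Q = 0)
    (hp : 0 < n * Q.real {x | ‖x.1 - xs‖ ≤ r}) :
    ∫ D : Fin n → Cov d × Fin 2, (∑ i, regWeight r w (radius xs D) φ i * ξ (D i)) ^ 2
      ∂(sampleLaw Q n) ≤ 6 / ((1 - φ) * (n * Q.real {x | ‖x.1 - xs‖ ≤ r})) := by
  set s := n * Q.real {x | ‖x.1 - xs‖ ≤ r} with hs
  have hφ : 0 < 1 - φ := by linarith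
  have hWm : ∀ i, Measurable fun D : Fin n → Cov d × Fin 2 => regWeight r w (radius xs D) φ i :=
    fun i => (measurable_regWeight r w φ i).comp (measurable_radius_sample xs)
  have hb : ∀ i (D : Fin n → Cov d × Fin 2),
      (regWeight r w (radius xs D) φ i * ξ (D i)) ^ 2 ≤ regWeight r w (radius xs D) φ i ^ 2 := by
    intro i D
    rw [mul_pow]
    exact mul_le_of_le_one_right (sq_nonneg _) ((sq_le_one_iff_abs_le_one _).mpr (hξ1 _))
  have hb2 : ∀ i (D : Fin n → Cov d × Fin 2),
      regWeight r w (radius xs D) φ i ^ 2 ≤ √(1 / (1 - φ)) ^ 2 := by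
    intro i D
    rw [← sq_abs]
    exact pow_le_pow_left₀ (abs_nonneg _) (abs_regWeight_le r w _ hφ1 i) 2
  have hint : ∀ i, Integrable (fun D : Fin n → Cov d × Fin 2 =>
      (regWeight r w (radius xs D) φ i * ξ (D i)) ^ 2) (sampleLaw Q n) := fun i => by
    refine Integrable.of_bound (((hWm i).mul
      (hξ.comp (measurable_pi_apply i))).pow_const 2).aestronglyMeasurable (√(1 / (1 - φ)) ^ 2)
      (Eventually.of_forall fun D => ?_)
    rw [Real.norm_of_nonneg (sq_nonneg _)]
    exact (hb i D).trans (hb2 i D)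
  have hZ := integrable_sq_nearCount_sub (Q := Q) (n := n) xs r s
  have h1 := integral_sq_sum_mul_eq (P := Q) (n := n) (measurable_radius d xs) hξ hξ1 horth
    (W := fun t i => regWeight r w t φ i) (fun i => measurable_regWeight r w φ i)
    (fun t i => abs_regWeight_le r w t hφ1 i)
  change ∫ D : Fin n → Cov d × Fin 2, (∑ i, regWeight r w (radius xs D) φ i * ξ (D i)) ^ 2
      ∂(sampleLaw Q n) = ∑ i, ∫ D : Fin n → Cov d × Fin 2,
        (regWeight r w (radius xs D) φ i * ξ (D i)) ^ 2 ∂(sampleLaw Q n) at h1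
  rw [h1, ← integral_finsetSum _ fun i _ => hint i]
  have h2 : ∫ D : Fin n → Cov d × Fin 2,
        ∑ i, (regWeight r w (radius xs D) φ i * ξ (D i)) ^ 2 ∂(sampleLaw Q n) ≤
      ∫ D : Fin n → Cov d × Fin 2, (2 / ((1 - φ) * s) +
        4 / ((1 - φ) * s ^ 2) * (nearCount r (radius xs D) - s) ^ 2) ∂(sampleLaw Q n) := by
    refine integral_mono (integrable_finsetSum _ fun i _ => hint i)
      ((integrable_const _).add (hZ.const_mul _)) fun D => ?_
    refine (Finset.sum_le_sum fun i _ => hb i D).trans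
      ((sum_regWeight_sq_le r w _ hφ1).trans ?_)
    have h3 := one_div_le_of_sq_sub hp (nearCount_eq_zero_or_one_le xs r D)
    calc 1 / ((1 - φ) * nearCount r (radius xs D))
        = 1 / (1 - φ) * (1 / nearCount r (radius xs D)) := by rw [one_div_mul_one_div]
      _ ≤ 1 / (1 - φ) * (2 / s + 4 / s ^ 2 * (nearCount r (radius xs D) - s) ^ 2) :=
          mul_le_mul_of_nonneg_left h3 (by positivity)
      _ = _ := by field_simp
  refine h2.trans ?_
  rw [integral_add (integrable_const _) (hZ.const_mul _), integral_const, integral_const_mul,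
    probReal_univ, one_smul]
  have h4 := integral_sq_nearCount_sub_le (Q := Q) xs n r
  rw [← hs] at h4
  have h5 : 4 / ((1 - φ) * s ^ 2) * ∫ D : Fin n → Cov d × Fin 2,
      (nearCount r (radius xs D) - s) ^ 2 ∂(sampleLaw Q n) ≤ 4 / ((1 - φ) * s ^ 2) * s :=
    mul_le_mul_of_nonneg_left h4 (by positivity)
  refine (add_le_add_right h5 _).trans_eq ?_
  field_simp
  norm_num

/-- The pointwise decomposition of the error of the estimator. -/
theorem sq_weightedSum_error_decomp {xs : Cov d} {r R : ℝ} (hrR : r ≤ R) {w : ℕ}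
    {φ : ℝ} (hφ1 : φ < 1) {a β C : ℝ} (ha : a ∈ Set.Icc (0 : ℝ) 1) (hβ : 0 < β) (hC : 0 ≤ C)
    {m : Cov d × Fin 2 → ℝ} {p : Polynomial ℝ} (hpdeg : p.natDegree ≤ w) (hp0 : p.eval 0 = a)
    {D : Fin n → Cov d × Fin 2} (hpos : ∀ i, 0 < radius xs D i)
    (hinj : Function.Injective (radius xs D))
    (hm : ∀ i, radius xs D i ≤ R → |m (D i) - p.eval (radius xs D i ^ 2)| ≤
      C * radius xs D i ^ β) {s : ℝ} (hs : 0 < s) :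
    (a - ∑ i, regWeight r w (radius xs D) φ i * label D i) ^ 2 ≤
      2 * (∑ i, regWeight r w (radius xs D) φ i * (label D i - m (D i))) ^ 2 +
        2 * ((C * r ^ β) ^ 2 / (1 - φ)) +
        (2 * (1 + w) / s + 4 / s ^ 2 * (nearCount r (radius xs D) - s) ^ 2) +
        Set.indicator {D | φ * numNearby xs r D ≤ zeta xs r D w} 1 D := by
  set t := radius xs D with ht
  have hφ : 0 < 1 - φ := by linarith
  have hind : 0 ≤ Set.indicator {D : Fin n → Cov d × Fin 2 | φ * numNearby xs r D ≤ zeta xs r D w}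
      (1 : (Fin n → Cov d × Fin 2) → ℝ) D := Set.indicator_nonneg (fun _ _ => zero_le_one) _
  have hnn : 0 ≤ 2 * (1 + w) / s + 4 / s ^ 2 * (nearCount r t - s) ^ 2 := by positivity
  by_cases hg : (1 + w : ℝ) ≤ nearCount r t ∧ projStat r w t ≤ φ * nearCount r t
  · have hN : 0 < nearCount r t := lt_of_lt_of_le (by positivity) hg.1
    have hpos' : 0 < nearCount r t - projStat r w t := by nlinarith [hg.2]
    have hunit := isUnit_det_gram r w t (by linarith [hg.1]) hpos hinj
    -- Exact reproduction of `p` at zero leaves only `m - p` as bias.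
    have hpoly : ∑ i, regWeight r w t φ i * p.eval (t i ^ 2) = a := by
      have h1 := sum_resid_mul_evenPolynomial r w t hunit fun c => p.coeff c
      have h2 : ∀ i, ∑ c : Fin (w + 1), p.coeff c * t i ^ (2 * (c : ℕ)) = p.eval (t i ^ 2) := by
        intro i
        rw [Polynomial.eval_eq_sum_range' (Nat.lt_succ_of_le hpdeg),
          ← Fin.sum_univ_eq_sum_range fun c => p.coeff c * (t i ^ 2) ^ c]
        simp only [pow_mul, Nat.succ_eq_add_one]
      simp only [h2] at h1
      simp only [regWeight, if_pos hg, div_mul_eq_mul_div, ← Finset.sum_div]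
      rw [h1, mul_div_cancel_right₀ _ hpos'.ne', ← hp0]
      simp [Polynomial.coeff_zero_eq_eval_zero]
    have hbias := sq_sum_regWeight_mul_le r w t hφ1
      (y := fun i => m (D i) - p.eval (t i ^ 2)) (B := C * r ^ β) fun i hi =>
        (hm i (hi.trans hrR)).trans (mul_le_mul_of_nonneg_left
          (Real.rpow_le_rpow (hpos i).le hi hβ.le) hC)
    set S := ∑ i, regWeight r w t φ i * (label D i - m (D i))
    set B := ∑ i, regWeight r w t φ i * (m (D i) - p.eval (t i ^ 2)) with hB
    have hsplit : a - ∑ i, regWeight r w t φ i * label D i = -(S + B) := by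
      rw [← hpoly, hB, ← Finset.sum_add_distrib, ← Finset.sum_sub_distrib, ← Finset.sum_neg_distrib]
      exact Finset.sum_congr rfl fun i _ => by ring
    rw [hsplit]
    nlinarith [sq_nonneg (S - B)]
  -- Off the good event the error is `a² ≤ 1`, paid for by the count term or by the indicator.
  · have hzero : ∑ i, regWeight r w t φ i * label D i = 0 := by
      simp only [regWeight, if_neg hg, zero_mul, Finset.sum_const_zero]
    rw [hzero, sub_zero]
    have ha2 : a ^ 2 ≤ 1 := pow_le_one₀ ha.1 ha.2
    have h1 : 0 ≤ 2 * (∑ i, regWeight r w t φ i * (label D i - m (D i))) ^ 2 := by positivity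
    have h2 : 0 ≤ 2 * ((C * r ^ β) ^ 2 / (1 - φ)) := by positivity
    rcases not_and_or.mp hg with h | h
    · have := one_le_of_sq_sub hs (by positivity : (0 : ℝ) ≤ 1 + w) (not_le.mp h).le
      linarith
    · have hmem : D ∈ {D : Fin n → Cov d × Fin 2 | φ * numNearby xs r D ≤ zeta xs r D w} := by
        rw [Set.mem_ofPred_eq, zeta_eq, numNearby_eq]
        exact (not_le.mp h).le
      rw [Set.indicator_of_mem hmem, Pi.one_apply]
      linarith

end Risk

end LRR

theorem theorem1
    (d : ℕ) (hd : 0 < d)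
    (Q : Measure (LRR.Cov d × Fin 2)) [IsProbabilityMeasure Q]
    (μ η : LRR.Cov d → ℝ)
    (hμ : LRR.IsCovariateDensity Q μ) (hη : LRR.IsLabelProbability Q η)
    (xs : LRR.Cov d) (R : ℝ) (hR : 0 < R) (hR1 : R < 1)
    (β : ℝ) (hβ : 0 < β)
    -- lower bound on the density near the query
    (l : ℝ) (hl : 0 < l) (hC1 : ∀ x ∈ Metric.closedBall xs R, l ≤ μ x)
    -- Hölder conditions near the query
    (hC2 : LRR.IsHolderOnBall β R xs μ)
    (hC2' : LRR.IsHolderOnBall β R xs (fun x => η x * μ x))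
    -- the radii
    (r : ℕ → ℝ) (hr_pos : ∀ n, 1 ≤ n → 0 < r n) (hr_zero : Tendsto r atTop (𝓝 0))
    (ν : ℝ) (hν : 0 < ν)
    (hr_rate : Tendsto (fun n : ℕ => (n : ℝ) ^ (1 - ν) * r n ^ d) atTop atTop)
    -- exponential tail bound on the projection statistic
    (φ : ℝ) (hφ : 0 < φ) (hφ1 : φ < 1)
    (hC3 : ∃ c C τ : ℝ, 0 < c ∧ 0 < C ∧ 0 < τ ∧ ∀ n : ℕ, 1 ≤ n →
      (LRR.sampleLaw Q n).real
        {D | φ * LRR.numNearby xs (r n) D ≤ LRR.zeta xs (r n) D (LRR.strictFloor (β / 2))}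
        ≤ C * Real.exp (-c * (n : ℝ) ^ τ)) :
    ∃ C : ℝ, 0 < C ∧ ∀ n : ℕ, 1 ≤ n →
      Integrable (fun D : Fin n → LRR.Cov d × Fin 2 =>
        (η xs - LRR.estimator xs (r n) D (LRR.strictFloor (β / 2)) φ) ^ 2)
        (LRR.sampleLaw Q n) ∧
      ∫ D : Fin n → LRR.Cov d × Fin 2,
        (η xs - LRR.estimator xs (r n) D (LRR.strictFloor (β / 2)) φ) ^ 2 ∂(LRR.sampleLaw Q n)
        ≤ C * max (r n ^ (2 * β)) (1 / ((n : ℝ) * r n ^ d)) := by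
  have hφ' : 0 < 1 - φ := by linarith
  set w := LRR.strictFloor (β / 2) with hw_def
  have hw : β ≤ 2 * ((w : ℝ) + 1) := by
    by_contra h
    have h1 : ((w + 1 : ℕ) : ℝ) < β / 2 := by push_cast; linarith
    exact absurd ((LRR.isGreatest_strictFloor (half_pos hβ)).2 h1) (by omega)
  obtain ⟨c, C₃, τ, hc, hC₃, hτ, htail⟩ := hC3
  obtain ⟨K, hK, hexp⟩ := LRR.exists_exp_neg_mul_rpow_le hc hτ
  obtain ⟨m, p, C, hm_meas, hm_mem, hpdeg, hp0, hC, horth, hbias⟩ :=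
    LRR.exists_radial_regression hd hμ hη hβ hR hR1 hl hC1 hC2 hC2' hw
  have ha := hη.mem_Icc xs
  set κ : ℝ := l * (volume : Measure (LRR.Cov d)).real (Metric.ball 0 1) with hκ_def
  have hκ : 0 < κ := mul_pos hl (ENNReal.toReal_pos
    (Metric.measure_ball_pos _ _ one_pos).ne' Metric.isBounded_ball.measure_lt_top.ne)
  -- `K₁` collects the terms of order `1 / (n r ^ d)`: stochastic error, too few neighbours, tail of
  -- `ζ`. `K₂` is the bias, and `K₃` handles the indices with `r n > R`, where `r n ^ (2β)` is
  -- bounded below.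
  set K₁ : ℝ := (2 * (6 / (1 - φ)) + 2 * (1 + w) + 4) / κ + C₃ * K with hK₁
  set K₂ : ℝ := 2 * (C ^ 2 / (1 - φ)) with hK₂
  set K₃ : ℝ := (2 + 2 / (1 - φ)) / R ^ (2 * β) with hK₃
  refine ⟨K₁ + K₂ + K₃, by positivity, fun n hn => ?_⟩
  have hrn := hr_pos n hn
  have hn0 : (0 : ℝ) < n := by exact_mod_cast hn
  have hae := LRR.sq_error_ae_eq (n := n) hd hμ xs (r n) w hφ1 (η xs)
  have hint := LRR.integrable_sq_weightedSum_error (Q := Q) (n := n) xs (r n) w hφ1 ha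
  refine ⟨hint.congr hae.symm, ?_⟩
  rw [integral_congr_ae hae]
  set Δ := max (r n ^ (2 * β)) (1 / ((n : ℝ) * r n ^ d)) with hΔ
  have hΔ1 : r n ^ (2 * β) ≤ Δ := le_max_left _ _
  have hΔ2 : 1 / ((n : ℝ) * r n ^ d) ≤ Δ := le_max_right _ _
  have hΔ0 : 0 ≤ Δ := (Real.rpow_nonneg hrn.le _).trans hΔ1
  have hK₁0 : 0 ≤ K₁ * Δ := by positivity
  have hK₂0 : 0 ≤ K₂ * Δ := by positivity
  have hK₃0 : 0 ≤ K₃ * Δ := by positivity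
  rcases le_or_gt (r n) R with hrR | hrR
  swap
  · have h1 : ∫ D : Fin n → LRR.Cov d × Fin 2,
        (η xs - ∑ i, LRR.regWeight (r n) w (LRR.radius xs D) φ i * LRR.label D i) ^ 2
          ∂(LRR.sampleLaw Q n) ≤ 2 + 2 / (1 - φ) := by
      refine (integral_mono hint (integrable_const (2 + 2 / (1 - φ))) fun D =>
        LRR.sq_weightedSum_error_le xs (r n) w hφ1 ha D).trans_eq ?_
      simp
    have h2 : R ^ (2 * β) ≤ Δ :=
      (Real.rpow_le_rpow hR.le hrR.le (by positivity)).trans hΔ1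
    have h3 : 2 + 2 / (1 - φ) ≤ K₃ * Δ := by
      rw [hK₃, div_mul_eq_mul_div, le_div_iff₀ (by positivity)]
      exact mul_le_mul_of_nonneg_left h2 (by positivity)
    linarith
  set q := Q.real {x | ‖x.1 - xs‖ ≤ r n} with hq
  have hqκ : κ * r n ^ d ≤ q := LRR.mul_pow_le_measure_radius_le xs hμ hC1 hrn.le hrR
  have hs_ge : κ * (n * r n ^ d) ≤ n * q := by
    calc κ * (n * r n ^ d) = n * (κ * r n ^ d) := by ring
      _ ≤ n * q := mul_le_mul_of_nonneg_left hqκ hn0.le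
  have hs : 0 < n * q := lt_of_lt_of_le (by positivity) hs_ge
  have hs_inv : 1 / (n * q) ≤ 1 / κ * Δ := by
    calc 1 / (n * q) ≤ 1 / (κ * (n * r n ^ d)) := one_div_le_one_div_of_le (by positivity) hs_ge
      _ = 1 / κ * (1 / (n * r n ^ d)) := by rw [one_div_mul_one_div]
      _ ≤ 1 / κ * Δ := mul_le_mul_of_nonneg_left hΔ2 (by positivity)
  set ξ : LRR.Cov d × Fin 2 → ℝ := fun x => ((x.2 : ℕ) : ℝ) - m x with hξ_def
  have hξ : Measurable ξ :=
    ((measurable_of_countable fun y : Fin 2 => ((y : ℕ) : ℝ)).comp measurable_snd).sub hm_meas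
  have hξ1 : ∀ x, |ξ x| ≤ 1 := fun x => by
    have h1 : ((x.2 : ℕ) : ℝ) ≤ 1 := by exact_mod_cast Nat.lt_succ_iff.mp x.2.2
    have h2 : (0 : ℝ) ≤ ((x.2 : ℕ) : ℝ) := by positivity
    have h3 := hm_mem x
    rw [abs_le]
    exact ⟨by simp only [hξ_def]; linarith [h3.2], by simp only [hξ_def]; linarith [h3.1]⟩
  have hstoch := LRR.integral_sq_stochastic_error_le xs (r n) w hφ1 hξ hξ1 horth hs
  have hZ := LRR.integrable_sq_nearCount_sub (Q := Q) (n := n) xs (r n) (n * q)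
  have hZ_le := LRR.integral_sq_nearCount_sub_le (Q := Q) xs n (r n)
  set T : Set (Fin n → LRR.Cov d × Fin 2) :=
    {D | φ * LRR.numNearby xs (r n) D ≤ LRR.zeta xs (r n) D w} with hT_def
  have hT : MeasurableSet T := by
    simp only [hT_def, LRR.zeta_eq, LRR.numNearby_eq]
    exact measurableSet_le
      (((LRR.measurable_nearCount (r n)).comp (LRR.measurable_radius_sample xs)).const_mul φ)
      ((LRR.measurable_projStat (r n) w).comp (LRR.measurable_radius_sample xs))
  have hT_le : (LRR.sampleLaw Q n).real T ≤ C₃ * K * Δ := by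
    refine (htail n hn).trans ?_
    rw [mul_assoc]
    refine mul_le_mul_of_nonneg_left ((hexp n hn).trans ?_) hC₃.le
    rw [div_eq_mul_one_div]
    refine mul_le_mul_of_nonneg_left (le_trans ?_ hΔ2) hK.le
    -- `1 / n ≤ 1 / (n r ^ d)` because `r n ≤ R < 1`.
    exact one_div_le_one_div_of_le (by positivity)
      (mul_le_of_le_one_right hn0.le (pow_le_one₀ hrn.le (hrR.trans hR1.le)))
  have hW : ∀ i, Measurable fun D : Fin n → LRR.Cov d × Fin 2 =>
      LRR.regWeight (r n) w (LRR.radius xs D) φ i :=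
    fun i => (LRR.measurable_regWeight (r n) w φ i).comp (LRR.measurable_radius_sample xs)
  have hS_int : Integrable (fun D : Fin n → LRR.Cov d × Fin 2 =>
      (∑ i, LRR.regWeight (r n) w (LRR.radius xs D) φ i * ξ (D i)) ^ 2) (LRR.sampleLaw Q n) := by
    refine Integrable.of_bound ((Finset.measurable_sum _ fun i _ => (hW i).mul
      (hξ.comp (measurable_pi_apply i))).pow_const 2).aestronglyMeasurable (1 ^ 2 / (1 - φ))
      (Eventually.of_forall fun D => ?_)
    rw [Real.norm_of_nonneg (sq_nonneg _)]
    exact LRR.sq_sum_regWeight_mul_le (r n) w _ hφ1 fun i _ => hξ1 (D i)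
  have hbias' : ∀ᵐ D ∂(LRR.sampleLaw Q n), ∀ i : Fin n, LRR.radius xs D i ≤ R →
      |m (D i) - p.eval (LRR.radius xs D i ^ 2)| ≤ C * LRR.radius xs D i ^ β :=
    ae_all_iff.mpr fun i => (Measure.tendsto_eval_ae_ae (μ := fun _ : Fin n => Q)
      (i := i)).eventually hbias
  have hT_int : Integrable (T.indicator (1 : (Fin n → LRR.Cov d × Fin 2) → ℝ))
      (LRR.sampleLaw Q n) := (integrable_indicator_iff hT).mpr (integrable_const 1).integrableOn
  have i1 := (hS_int.const_mul 2).add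
    (integrable_const (μ := LRR.sampleLaw Q n) (2 * ((C * r n ^ β) ^ 2 / (1 - φ))))
  have i2 := (integrable_const (μ := LRR.sampleLaw Q n) (2 * (1 + (w : ℝ)) / (n * q))).add
    (hZ.const_mul (4 / (n * q) ^ 2))
  have hmain := integral_mono_ae hint ((i1.add i2).add hT_int) (by
    filter_upwards [LRR.ae_radius_pos_and_injective hd hμ xs, hbias'] with D hD hDb
    exact LRR.sq_weightedSum_error_decomp hrR hφ1 ha hβ hC hpdeg hp0 hD.1 hD.2 hDb hs)
  refine hmain.trans ?_
  rw [integral_add' (i1.add i2) hT_int, integral_add' i1 i2,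
    integral_add' (hS_int.const_mul 2) (integrable_const _),
    integral_add' (integrable_const _) (hZ.const_mul _), integral_indicator_one hT,
    integral_const, integral_const, integral_const_mul (4 / (n * q) ^ 2),
    integral_const_mul (2 : ℝ), probReal_univ,
    one_smul, one_smul]
  have b1 : 2 * (6 / ((1 - φ) * (n * q))) ≤ 2 * (6 / (1 - φ)) / κ * Δ := by
    calc 2 * (6 / ((1 - φ) * (n * q))) = 2 * (6 / (1 - φ)) * (1 / (n * q)) := by
          field_simp
      _ ≤ 2 * (6 / (1 - φ)) * (1 / κ * Δ) := mul_le_mul_of_nonneg_left hs_inv (by positivity)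
      _ = _ := by ring
  have b2 : 2 * ((C * r n ^ β) ^ 2 / (1 - φ)) ≤ K₂ * Δ := by
    have e : r n ^ (2 * β) = (r n ^ β) ^ 2 := by
      rw [mul_comm, Real.rpow_mul hrn.le, Real.rpow_two]
    calc 2 * ((C * r n ^ β) ^ 2 / (1 - φ)) = K₂ * r n ^ (2 * β) := by
          rw [e, hK₂]; ring
      _ ≤ K₂ * Δ := mul_le_mul_of_nonneg_left hΔ1 (by positivity)
  have b3 : 2 * (1 + (w : ℝ)) / (n * q) ≤ 2 * (1 + w) / κ * Δ := by
    calc 2 * (1 + (w : ℝ)) / (n * q) = 2 * (1 + w) * (1 / (n * q)) := by ring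
      _ ≤ 2 * (1 + w) * (1 / κ * Δ) := mul_le_mul_of_nonneg_left hs_inv (by positivity)
      _ = _ := by ring
  have b4 : 4 / (n * q) ^ 2 * ∫ D : Fin n → LRR.Cov d × Fin 2,
      (LRR.nearCount (r n) (LRR.radius xs D) - n * q) ^ 2 ∂(LRR.sampleLaw Q n) ≤ 4 / κ * Δ := by
    calc _ ≤ 4 / (n * q) ^ 2 * (n * q) := mul_le_mul_of_nonneg_left hZ_le (by positivity)
      _ = 4 * (1 / (n * q)) := by field_simp
      _ ≤ 4 * (1 / κ * Δ) := mul_le_mul_of_nonneg_left hs_inv (by positivity)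
      _ = _ := by ring
  have hK₁Δ : K₁ * Δ = 2 * (6 / (1 - φ)) / κ * Δ + 2 * (1 + w) / κ * Δ + 4 / κ * Δ +
      C₃ * K * Δ := by
    rw [hK₁]; ring
  have b5 := mul_le_mul_of_nonneg_left hstoch (by norm_num : (0 : ℝ) ≤ 2)
  rw [add_mul, add_mul, hK₁Δ]
  linarith [b5.trans b1]
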